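/- **Analytic distillates.** A transmonomial in $w$ is a function $w^{\alpha}(\log w)^k\exp\bigl(\sum_{j}c_j w^{-\gamma_j}\bigr)$ (finite sum, $\alpha\in\mathbb R$, $k\in\mathbb Z$, $c_j\in\mathbb C$, $\gamma_j>0$, principal branches). A function $f$ has the transseries expansion $\sum_\mu c_\mu\,\mu(z-z_0)$ as $z\to z_0$ in $S$ if the transmonomials that occur can be listed as $m_0,m_1,\dots$ with $m_{k+1}(z-z_0)=o(m_k(z-z_0))$, for each $n$ some $m_k(z-z_0)=O((z-z_0)^n)$, and $f(z)-\sum_{k<N}c_{m_k}m_k(z-z_0)=O(m_N(z-z_0))$ for all $N$, all as $z\to z_0$ in $S$. Let $f$ be defined on $D\subset\mathbb C$, and suppose that $D\setminus\{z_0\}$ is covered by non-degenerate closed sectors with vertex $z_0$ (sets $\{z\ne z_0: a\le\arg(z-z_0)\le b\}$ with $-\pi\le a<b\le\pi$), each contained in $D$ near $z_0$, such that $f$ has a transseries expansion in the intersection of $D$ with each of them. If the power series formed with those coefficients of $(z-z_0)^n$, $n\ge 0$, that are common to all the sectors (with $0$ in place of a coefficient on which the sectors disagree) has positive radius of convergence,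 the analytic function that it defines is the analytic distillate $\operatorname{dist}_{z=z_0}f$. **The exact series.** Let $\beta_0>0$, $r\ge 0$. For the vacuum-subtracted thermal stress-energy tensor $\langle\hat T_{\mu\nu}\rangle=\rho\,u_\mu u_\nu-p\,\Delta_{\mu\nu}+\mathcal A\,A_\mu A_\nu$ of the minimally coupled massless real scalar field in anti-de Sitter space (Dirichlet boundary conditions), write $d(w)=1-r^2\kappa^2+(1+r^2\kappa^2)\cosh w$, $w_n=n\kappa\beta_0$, and $$P_0(w)=(3-3\kappa^4r^4)\cosh 2w+4(3\kappa^4r^4+2\kappa^2r^2+1)\cosh w-9\kappa^4r^4-8\kappa^2r^2+1 .$$ The scalars are given by the exact series (Ambruş et al.) $$\rho=\frac{3\kappa^4}{8\pi^2(1+\kappa^2r^2)^2}\sum_{n\ge1}\frac{1}{d(w_n)\sinh^4(w_n/2)},\qquad p=\frac{\kappa^4}{16\pi^2(1+\kappa^2r^2)^2}\sum_{n\ge1}\frac{P_0(w_n)}{d(w_n)^3\sinh^4(w_n/2)},$$ $$\mathcal A=\frac{\kappa^2}{2\pi^2(1+r^2\kappa^2)}\sum_{n\ge1}\frac{3(\kappa^2r^2+1)\cosh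 w_n-3\kappa^2r^2-1}{d(w_n)^3\sinh^2(w_n/2)} .$$ Regard them as functions of $z=\kappa^2$ with $\kappa=z^{1/2}$, on the domain $D$ of all $z\in\mathbb C\setminus(-\infty,0]$ such that $d(w_n)\neq0$ for all $n\ge1$. **Claim 1.** The domain $D$ contains all real $\kappa^2>0$, the three series converge absolutely on $D$, and the analytic distillates in $\kappa^2=0$ exist and are $$\operatorname{dist}_{\kappa^2=0}\rho=\frac{\pi^2}{30(1+r^2\kappa^2)^2\beta_0^4}-\frac{\kappa^2(5+3r^2\kappa^2)}{24(1+r^2\kappa^2)^2\beta_0^2}-\frac{\kappa^4(71+105r^2\kappa^2+45r^4\kappa^4)}{480\pi^2(1+r^2\kappa^2)^2},$$ $$\operatorname{dist}_{\kappa^2=0}p=\frac{\pi^2}{90(1+r^2\kappa^2)^2\beta_0^4}+\frac{\kappa^2(1-3r^2\kappa^2)}{72(1+r^2\kappa^2)^2\beta_0^2}+\frac{\kappa^4(139+255r^2\kappa^2+135r^4\kappa^4)}{1440\pi^2(1+r^2\kappa^2)^2},$$ $$\operatorname{dist}_{\kappa^2=0}\mathcal A=\frac{1}{12(1+r^2\kappa^2)\beta_0^2}+\frac{\kappa^2}{48\pi^2(1+r^2\kappa^2)}$$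 (rational functions of $\kappa^2$, by which the distillates are continued to all $\kappa^2>0$). **Claim 2.** Let $\kappa>0$ and consider the AdS metric $ds^2=(1+r^2\kappa^2)dt^2-(1+r^2\kappa^2)^{-1}dr^2-r^2(d\theta^2+\sin^2\theta\,d\varphi^2)$ at a point of the chart $r>0$, $0<\theta<\pi$, with the Killing vector $\beta^\mu=\beta_0(1,0,0,0)$, $\beta^2=g_{\mu\nu}\beta^\mu\beta^\nu$, $u=\beta/\sqrt{\beta^2}$, $T=1/\sqrt{\beta^2}$, $A_\mu=u^\nu\nabla_\nu u_\mu$, $A^2=g^{\mu\nu}A_\mu A_\nu$, the curvature scalar $R=g^{\mu\nu}R^{\alpha}{}_{\mu\alpha\nu}$ for the convention $R^\mu{}_{\nu\rho\sigma}=\partial_\sigma\Gamma^\mu_{\nu\rho}-\partial_\rho\Gamma^\mu_{\nu\sigma}+\Gamma^\mu_{\sigma\alpha}\Gamma^\alpha_{\nu\rho}-\Gamma^\mu_{\rho\alpha}\Gamma^\alpha_{\nu\sigma}$, and $T_U^2=\frac{1}{4\pi^2}\bigl(\frac{R}{12}-A^2\bigr)$. Then the three functions of Claim 1 equal $$\rho=\frac{\pi^2}{30\beta^4}+\frac{1}{12\beta^2}\Bigl(\frac52\frac{R}{12}-A^2\Bigr)+\frac{1}{480\pi^2}\Bigl(-71\bigl(\tfrac{R}{12}\bigr)^2+37\tfrac{R}{12}A^2-11A^4\Bigr),$$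 $$p=\frac{\pi^2}{90\beta^4}+\frac{1}{18\beta^2}\Bigl(A^2-\frac14\frac{R}{12}\Bigr)+\frac{1}{1440\pi^2}\Bigl(139\bigl(\tfrac{R}{12}\bigr)^2-23\tfrac{R}{12}A^2+19A^4\Bigr),\qquad \mathcal A=\frac{1}{12\beta^2}-\frac{1}{48\pi^2}\Bigl(\frac{R}{12}-A^2\Bigr),$$ and equivalently $$\rho=\frac{\pi^2}{30}\bigl(T^4+10T^2T_U^2-11T_U^4\bigr)+\frac{R}{96}\bigl(T^2-T_U^2\bigr)-\frac{3}{32\pi^2}\bigl(\tfrac{R}{12}\bigr)^2,$$ $$p=\frac{\pi^2}{90}\bigl(T^4-20T^2T_U^2+19T_U^4\bigr)+\frac{R}{288}\bigl(T^2-T_U^2\bigr)+\frac{3}{32\pi^2}\bigl(\tfrac{R}{12}\bigr)^2,\qquad \mathcal A=\frac1{12}\bigl(T^2-T_U^2\bigr).$$ -/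

import Mathlib

open Filter Topology Asymptotics

noncomputable section

namespace AdSDistillate

/-! ### Transseries and analytic distillates -/

/-- A power-log-exponential transmonomial in a local variable `w`,
`w ^ α * (log w) ^ k * exp (∑ γ, c γ * w ^ (-γ))` with `α` real, `k` an integer and finitely many
exponents `γ > 0`.  They form a group under multiplication, containing all integer powers. -/
structure Transmonomial where
  power : ℝ
  logPower : ℤ
  exponent : Set.Ioi (0 : ℝ) →₀ ℂ

/-- The value of a transmonomial (principal branches of powers and logarithm). -/
def Transmonomial.eval (m : Transmonomial) (w : ℂ) : ℂ :=
  w ^ (m.power : ℂ) * Complex.log w ^ m.logPower *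
    Complex.exp (m.exponent.sum fun γ c => c * w ^ (-((γ : ℝ) : ℂ)))

/-- The transmonomial `w ^ n`. -/
def Transmonomial.intPow (n : ℤ) : Transmonomial := ⟨n, 0, 0⟩

/-- The family of coefficients `c` is a transseries expansion of `f` in `z - z₀` as `z → z₀` in `S`:
the transmonomials that occur can be listed in an order of strictly decreasing size (a listed one may
have coefficient `0`), the list gets smaller than every integer power, and the error of each partial
sum is of the order of the first omitted transmonomial. -/
def HasTransseries (f : ℂ → ℂ) (z₀ : ℂ) (S : Set ℂ) (c : Transmonomial → ℂ) : Prop :=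
  ∃ m : ℕ → Transmonomial,
    (∀ k, (fun z => (m (k + 1)).eval (z - z₀)) =o[𝓝[S] z₀] fun z => (m k).eval (z - z₀)) ∧
    (∀ n : ℕ, ∃ k, (fun z => (m k).eval (z - z₀)) =O[𝓝[S] z₀] fun z => (z - z₀) ^ n) ∧
    (∀ μ, μ ∉ Set.range m → c μ = 0) ∧
    ∀ N, (fun z => f z - ∑ k ∈ Finset.range N, c (m k) * (m k).eval (z - z₀))
      =O[𝓝[S] z₀] fun z => (m N).eval (z - z₀)

/-- The sector with vertex `z₀` of directions between the angles `s.1` and `s.2`. -/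
def sector (z₀ : ℂ) (s : ℝ × ℝ) : Set ℂ :=
  {z | z ≠ z₀ ∧ s.1 ≤ Complex.arg (z - z₀) ∧ Complex.arg (z - z₀) ≤ s.2}

/-- `g` is the analytic distillate in `z₀` of the function `f` with domain `D`: the domain is covered
by its intersections with non-degenerate closed sectors, `f` has a transseries expansion in each of
them, and `g` is the sum of the power series (of positive radius of convergence) formed with those
coefficients of the powers `(z - z₀) ^ n`, `n ≥ 0`, that are common to all the sectors (the
coefficient is `0` where the sectors disagree). -/
def IsAnalyticDistillate (f : ℂ → ℂ) (D : Set ℂ) (z₀ : ℂ) (g : ℂ → ℂ) : Prop :=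
  ∃ (𝒮 : Set (ℝ × ℝ)) (c : ℝ × ℝ → Transmonomial → ℂ) (a : ℕ → ℂ),
    𝒮.Nonempty ∧
    (∀ s ∈ 𝒮, -Real.pi ≤ s.1 ∧ s.1 < s.2 ∧ s.2 ≤ Real.pi) ∧
    (∀ s ∈ 𝒮, ∃ ε > 0, Metric.ball z₀ ε ∩ sector z₀ s ⊆ D) ∧
    D \ {z₀} ⊆ ⋃ s ∈ 𝒮, sector z₀ s ∧
    (∀ s ∈ 𝒮, HasTransseries f z₀ (D ∩ sector z₀ s) (c s)) ∧
    (∀ n : ℕ, (∀ s ∈ 𝒮, c s (Transmonomial.intPow n) = a n) ∨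
      (a n = 0 ∧ ∃ s ∈ 𝒮, ∃ s' ∈ 𝒮,
        c s (Transmonomial.intPow n) ≠ c s' (Transmonomial.intPow n))) ∧
    HasFPowerSeriesAt g (FormalMultilinearSeries.ofScalars ℂ a) z₀

/-! ### The exact thermal series of the minimally coupled massless scalar in AdS

`β₀` is the inverse global temperature, `r` the radial coordinate, `κ` the (complexified) inverse AdS
radius. -/

/-- `1 - r²κ² + (1 + r²κ²) cosh w`. -/
def denom (r : ℝ) (κ w : ℂ) : ℂ :=
  1 - r ^ 2 * κ ^ 2 + (1 + r ^ 2 * κ ^ 2) * Complex.cosh w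

/-- The numerator `P₀`. -/
def numP (r : ℝ) (κ w : ℂ) : ℂ :=
  (3 - 3 * κ ^ 4 * r ^ 4) * Complex.cosh (2 * w)
    + 4 * (3 * κ ^ 4 * r ^ 4 + 2 * κ ^ 2 * r ^ 2 + 1) * Complex.cosh w
    - 9 * κ ^ 4 * r ^ 4 - 8 * κ ^ 2 * r ^ 2 + 1

/-- The summand of the energy density, at `w = n κ β₀`. -/
def rhoTerm (r : ℝ) (κ w : ℂ) : ℂ :=
  1 / (denom r κ w * Complex.sinh (w / 2) ^ 4)

/-- The summand of the pressure, at `w = n κ β₀`. -/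
def pTerm (r : ℝ) (κ w : ℂ) : ℂ :=
  numP r κ w / (denom r κ w ^ 3 * Complex.sinh (w / 2) ^ 4)

/-- The summand of the coefficient of `A_μ A_ν`, at `w = n κ β₀`. -/
def aTerm (r : ℝ) (κ w : ℂ) : ℂ :=
  (3 * (κ ^ 2 * r ^ 2 + 1) * Complex.cosh w - 3 * κ ^ 2 * r ^ 2 - 1) /
    (denom r κ w ^ 3 * Complex.sinh (w / 2) ^ 2)

/-- The energy density `ρ`. -/
def rho (β₀ r : ℝ) (κ : ℂ) : ℂ :=
  3 * κ ^ 4 / (8 * (Real.pi : ℂ) ^ 2 * (1 + κ ^ 2 * r ^ 2) ^ 2) *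
    ∑' n : ℕ, rhoTerm r κ ((n + 1 : ℕ) * κ * β₀)

/-- The pressure `p`. -/
def pressure (β₀ r : ℝ) (κ : ℂ) : ℂ :=
  κ ^ 4 / (16 * (Real.pi : ℂ) ^ 2 * (1 + κ ^ 2 * r ^ 2) ^ 2) *
    ∑' n : ℕ, pTerm r κ ((n + 1 : ℕ) * κ * β₀)

/-- The coefficient `𝒜` of `A_μ A_ν`. -/
def aCoeff (β₀ r : ℝ) (κ : ℂ) : ℂ :=
  κ ^ 2 / (2 * (Real.pi : ℂ) ^ 2 * (1 + r ^ 2 * κ ^ 2)) *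
    ∑' n : ℕ, aTerm r κ ((n + 1 : ℕ) * κ * β₀)

/-- `κ = (κ²)^{1/2}`, the root with positive real part off the negative real axis. -/
def kappaOf (z : ℂ) : ℂ := z ^ (1 / 2 : ℂ)

/-- The domain in the variable `z = κ²`: the plane cut along `(-∞, 0]`, without the poles of the
summands. -/
def domain (β₀ r : ℝ) : Set ℂ :=
  {z | z ∈ Complex.slitPlane ∧
    ∀ n : ℕ, denom r (kappaOf z) ((n + 1 : ℕ) * kappaOf z * β₀) ≠ 0}

/-! ### The closed forms, as functions of `z = κ²` -/

def rhoDist (β₀ r : ℝ) (z : ℂ) : ℂ :=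
  (Real.pi : ℂ) ^ 2 / (30 * (1 + r ^ 2 * z) ^ 2 * β₀ ^ 4)
    - z * (5 + 3 * r ^ 2 * z) / (24 * (1 + r ^ 2 * z) ^ 2 * β₀ ^ 2)
    - z ^ 2 * (71 + 105 * r ^ 2 * z + 45 * r ^ 4 * z ^ 2) /
        (480 * (Real.pi : ℂ) ^ 2 * (1 + r ^ 2 * z) ^ 2)

def pDist (β₀ r : ℝ) (z : ℂ) : ℂ :=
  (Real.pi : ℂ) ^ 2 / (90 * (1 + r ^ 2 * z) ^ 2 * β₀ ^ 4)
    + z * (1 - 3 * r ^ 2 * z) / (72 * (1 + r ^ 2 * z) ^ 2 * β₀ ^ 2)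
    + z ^ 2 * (139 + 255 * r ^ 2 * z + 135 * r ^ 4 * z ^ 2) /
        (1440 * (Real.pi : ℂ) ^ 2 * (1 + r ^ 2 * z) ^ 2)

/-- This is `((1 + r²z) / (r²z²)) * (r²z² / (12 (1 + r²z)² β₀²) + r²z³ / (48 π² (1 + r²z)²))` with
the common factors cancelled, so that it also makes sense at `r = 0` and at `z = 0`. -/
def aDist (β₀ r : ℝ) (z : ℂ) : ℂ :=
  1 / (12 * (1 + r ^ 2 * z) * β₀ ^ 2) + z / (48 * (Real.pi : ℂ) ^ 2 * (1 + r ^ 2 * z))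

/-! ### Tensors in a coordinate chart, signature `(+,-,-,-)` -/

/-- The partial derivative `∂_μ F`. -/
def pd (μ : Fin 4) (F : (Fin 4 → ℝ) → ℝ) (x : Fin 4 → ℝ) : ℝ :=
  deriv (fun s => F (Function.update x μ s)) (x μ)

/-- A field of metric tensors `g_{μν}`. -/
abbrev Metric4 := (Fin 4 → ℝ) → Matrix (Fin 4) (Fin 4) ℝ

/-- `Γ^l_{μν}`. -/
def christoffel (g : Metric4) (l μ ν : Fin 4) (x : Fin 4 → ℝ) : ℝ :=
  1 / 2 * ∑ σ, (g x)⁻¹ l σ *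
    (pd μ (fun y => g y σ ν) x + pd ν (fun y => g y σ μ) x - pd σ (fun y => g y μ ν) x)

/-- `R^μ_{νρσ} = ∂_σ Γ^μ_{νρ} - ∂_ρ Γ^μ_{νσ} + Γ^μ_{σα} Γ^α_{νρ} - Γ^μ_{ρα} Γ^α_{νσ}`. -/
def riemann (g : Metric4) (μ ν ρ σ : Fin 4) (x : Fin 4 → ℝ) : ℝ :=
  pd σ (christoffel g μ ν ρ) x - pd ρ (christoffel g μ ν σ) x
    + ∑ α, (christoffel g μ σ α x * christoffel g α ν ρ x
      - christoffel g μ ρ α x * christoffel g α ν σ x)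

/-- `R_{μν} = R^α_{μαν}`. -/
def ricci (g : Metric4) (μ ν : Fin 4) (x : Fin 4 → ℝ) : ℝ := ∑ α, riemann g α μ α ν x

/-- The curvature scalar `R = g^{μν} R_{μν}`. -/
def scalarCurvature (g : Metric4) (x : Fin 4 → ℝ) : ℝ :=
  ∑ μ, ∑ ν, (g x)⁻¹ μ ν * ricci g μ ν x

/-- `β² = g_{μν} β^μ β^ν` for a vector field `β`. -/
def normSq (g : Metric4) (β : (Fin 4 → ℝ) → Fin 4 → ℝ) (x : Fin 4 → ℝ) : ℝ :=
  ∑ μ, ∑ ν, g x μ ν * β x μ * β x ν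

/-- The four-velocity `u^μ = β^μ / √β²`. -/
def velocity (g : Metric4) (β : (Fin 4 → ℝ) → Fin 4 → ℝ) (x : Fin 4 → ℝ) (μ : Fin 4) : ℝ :=
  β x μ / Real.sqrt (normSq g β x)

/-- `u_μ = g_{μν} u^ν`. -/
def velocityLow (g : Metric4) (β : (Fin 4 → ℝ) → Fin 4 → ℝ) (x : Fin 4 → ℝ) (μ : Fin 4) : ℝ :=
  ∑ ν, g x μ ν * velocity g β x ν

/-- The four-acceleration `A_μ = u^ν ∇_ν u_μ = u^ν (∂_ν u_μ - Γ^l_{νμ} u_l)`. -/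
def acceleration (g : Metric4) (β : (Fin 4 → ℝ) → Fin 4 → ℝ) (x : Fin 4 → ℝ) (μ : Fin 4) : ℝ :=
  ∑ ν, velocity g β x ν *
    (pd ν (fun y => velocityLow g β y μ) x - ∑ l, christoffel g l ν μ x * velocityLow g β x l)

/-- `A² = g^{μν} A_μ A_ν`. -/
def accelerationSq (g : Metric4) (β : (Fin 4 → ℝ) → Fin 4 → ℝ) (x : Fin 4 → ℝ) : ℝ :=
  ∑ μ, ∑ ν, (g x)⁻¹ μ ν * acceleration g β x μ * acceleration g β x ν

/-- The proper temperature `T = 1 / √β²`. -/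
def temperature (g : Metric4) (β : (Fin 4 → ℝ) → Fin 4 → ℝ) (x : Fin 4 → ℝ) : ℝ :=
  1 / Real.sqrt (normSq g β x)

/-- The square of the Unruh temperature, `T_U² = (R / 12 - A²) / (4π²)` (it may be negative). -/
def unruhSq (g : Metric4) (β : (Fin 4 → ℝ) → Fin 4 → ℝ) (x : Fin 4 → ℝ) : ℝ :=
  (scalarCurvature g x / 12 - accelerationSq g β x) / (4 * Real.pi ^ 2)

/-- The AdS metric in the coordinates `(t, r, θ, φ)`:
`(1 + r²κ²) dt² - (1 + r²κ²)⁻¹ dr² - r² (dθ² + sin² θ dφ²)`. -/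
def adsMetric (κ : ℝ) : Metric4 := fun x =>
  Matrix.diagonal ![1 + x 1 ^ 2 * κ ^ 2, -(1 + x 1 ^ 2 * κ ^ 2)⁻¹, -x 1 ^ 2,
    -(x 1 ^ 2 * Real.sin (x 2) ^ 2)]

/-- The four-temperature `β^μ = β₀ (1, 0, 0, 0)`. -/
def fourTemperature (β₀ : ℝ) : (Fin 4 → ℝ) → Fin 4 → ℝ := fun _ => ![β₀, 0, 0, 0]

end AdSDistillate

end

namespace AdSDistillate

open MeasureTheory Metric

/-! With `s = sinh² (w/2)`, `z = κ²` and `a = 1 + r² z`, the denominator `denom` is `2 (1 + a s)`.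
Partial fractions in `s` (`rhoTerm_eq`, `pTerm_eq`, `aTerm_eq`) therefore reduce the three series to
`∑ s⁻²`, `∑ s⁻¹` and `∑ (1 + a s)⁻ʲ` over `w = n κ β₀`, with coefficients polynomial in `z`.

The analytic engine is `WedgeDecay.exists_norm_tsum_sub_le`. For an even `g`, holomorphic with
quadratic decay around a double sector, Poisson summation along the ray through `t` gives `∑_{n ≥ 1}
g (n t) = I / t - g 0 / 2` up to an error smaller than every power of `t`. With `t = κ β₀` the first
term is odd in `κ` and the second is constant. The sums of `s⁻¹` and `s⁻²` fit this pattern once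
their principal parts at `0` are removed; these are even in `κ` and are summed by `ζ(2)` and `ζ(4)`.
The summand `(1 + a s)⁻ʲ` depends on `z` itself; it is expanded in powers of `r² z` by means of `1 +
a s = cosh² (w/2) (1 + r² z tanh² (w/2))` (`powAsymp_tsum_inv_one_add_mul`).

The prefactors are functions of `κ²`, so each scalar is exactly `g z + κ H z`, where the rational
function `g` collects the even contributions and `H` has an asymptotic power series in `z`. The
terms of `κ H` are half-odd powers of `z`. Hence the coefficients of the integer powers are the
Taylor coefficients of `g`, the same in every sector `|arg z| ≤ θ < π`, and `g` is the distillate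
(`isAnalyticDistillate_of_powAsymp`).

The second claim is a computation in the chart: `R = -12 κ²`, `A² = -r² κ⁴ / (1 + r² κ²)` and `β² =
(1 + r² κ²) β₀²`. After that all the formulas are rational identities. -/

/-! ### Wedges around the real axis and sectors of directions. -/

/-- The complex neighbourhood `|Im w| < ρ + C |Re w|` of a double sector around the real axis. -/
def wedge (ρ C : ℝ) : Set ℂ := {w | |w.im| < ρ + C * |w.re|}

/-- Holomorphic functions on a wedge that decay quadratically there. -/
def WedgeDecay (ρ C : ℝ) (g : ℂ → ℂ) : Prop :=
  DifferentiableOn ℂ g (wedge ρ C) ∧ ∃ K : ℝ, ∀ w ∈ wedge ρ C, ‖g w‖ ≤ K / (1 + ‖w‖ ^ 2)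

/-- The open sector `|Im t| < C Re t`. -/
def openSector (C : ℝ) : Set ℂ := {t | |t.im| < C * t.re}

lemma isOpen_wedge (ρ C : ℝ) : IsOpen (wedge ρ C) :=
  isOpen_lt (by fun_prop) (by fun_prop)

lemma isOpen_openSector (C : ℝ) : IsOpen (openSector C) :=
  isOpen_lt (by fun_prop) (by fun_prop)

lemma convex_openSector (C : ℝ) : Convex ℝ (openSector C) := by
  intro x hx y hy a b ha hb hab
  simp only [openSector, Set.mem_ofPred_eq, abs_lt] at hx hy ⊢
  have e1 : (a • x + b • y).im = a * x.im + b * y.im := by simp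
  have e2 : (a • x + b • y).re = a * x.re + b * y.re := by simp
  rw [e1, e2]
  rcases ha.eq_or_lt with h | h
  · have : b = 1 := by linarith
    subst h this
    constructor <;> linarith
  · constructor <;> nlinarith

lemma re_pos_of_mem_openSector {C : ℝ} (hC : 0 < C) {t : ℂ} (ht : t ∈ openSector C) : 0 < t.re := by
  have h : |t.im| < C * t.re := ht
  have := abs_nonneg t.im
  by_contra hh
  nlinarith

lemma ne_zero_of_mem_openSector {C : ℝ} {t : ℂ} (ht : t ∈ openSector C) : t ≠ 0 := by
  rintro rfl
  simp [openSector] at ht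

lemma mul_real_mem_wedge {ρ C : ℝ} (hρ : 0 < ρ) {t : ℂ} (hC : 0 < C) (ht : t ∈ openSector C)
    (x : ℝ) : t * x ∈ wedge ρ C := by
  have h : |t.im| < C * t.re := ht
  have h0 := re_pos_of_mem_openSector hC ht
  simp only [wedge, Set.mem_ofPred_eq, Complex.mul_re, Complex.mul_im, Complex.ofReal_re,
    Complex.ofReal_im, mul_zero, sub_zero, zero_add, abs_mul, abs_of_pos h0]
  nlinarith [abs_nonneg x]

lemma zero_mem_wedge {ρ C : ℝ} (hρ : 0 < ρ) : (0 : ℂ) ∈ wedge ρ C := by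
  simp [wedge, hρ]

/-- Moving `w` by `η` changes `|Im w| - C |Re w|` by at most `(1 + C) η`, which is `ρ / 2` for this
radius. -/
lemma closedBall_subset_wedge {ρ C : ℝ} (hC : 0 ≤ C) {w : ℂ}
    (hw : w ∈ wedge (ρ / 2) C) : closedBall w (ρ / (2 * (1 + C))) ⊆ wedge ρ C := by
  intro v hv
  rw [mem_closedBall, dist_eq_norm] at hv
  have h1 := Complex.abs_re_le_norm (v - w)
  have h2 := Complex.abs_im_le_norm (v - w)
  have h : |w.im| < ρ / 2 + C * |w.re| := hw
  simp only [Complex.sub_re, Complex.sub_im] at h1 h2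
  have h3 : |v.im| ≤ |w.im| + |v.im - w.im| := by
    have := abs_add_le w.im (v.im - w.im); simpa using this
  have h4 : |w.re| ≤ |v.re| + |v.re - w.re| := by
    have := abs_sub_abs_le_abs_sub w.re v.re
    rw [abs_sub_comm w.re] at this; linarith
  have e : (1 + C) * (ρ / (2 * (1 + C))) = ρ / 2 := by field_simp
  have h5 := mul_le_mul_of_nonneg_left h4 hC
  have h6 := mul_le_mul_of_nonneg_left (h1.trans hv) hC
  show |v.im| < ρ + C * |v.re|
  nlinarith

/-! ### Cauchy estimates, restriction to rays and Fourier decay. -/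

namespace WedgeDecay

variable {ρ C : ℝ} {g : ℂ → ℂ}

lemma exists_bound (h : WedgeDecay ρ C g) :
    ∃ K : ℝ, 0 ≤ K ∧ ∀ w ∈ wedge ρ C, ‖g w‖ ≤ K / (1 + ‖w‖ ^ 2) := by
  obtain ⟨-, K, hK⟩ := h
  refine ⟨max K 0, le_max_right _ _, fun w hw => (hK w hw).trans ?_⟩
  gcongr
  exact le_max_left _ _

/-- Cauchy's estimate on circles of one fixed radius; halving the width makes room for them. -/
lemma deriv (hρ : 0 < ρ) (hC : 0 ≤ C) (h : WedgeDecay ρ C g) :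
    WedgeDecay (ρ / 2) C (deriv g) := by
  obtain ⟨K, hK0, hK⟩ := h.exists_bound
  have hsub : wedge (ρ / 2) C ⊆ wedge ρ C := by
    intro w hw
    have h : |w.im| < ρ / 2 + C * |w.re| := hw
    show |w.im| < ρ + C * |w.re|
    linarith
  refine ⟨(h.1.deriv (isOpen_wedge _ _)).mono hsub, ?_⟩
  set η := ρ / (2 * (1 + C)) with hη
  have hη0 : 0 < η := by positivity
  -- The factor `2 + 2 η²` compares `1 + ‖w‖²` with `1 + ‖v‖²` for points at distance `η`.
  refine ⟨K * (2 + 2 * η ^ 2) / η, fun w hw => ?_⟩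
  have hb := closedBall_subset_wedge hC hw
  rw [← hη] at hb
  have := Complex.norm_deriv_le_of_forall_mem_sphere_norm_le (c := w) (R := η) (f := g)
    (C := K * (2 + 2 * η ^ 2) / (1 + ‖w‖ ^ 2)) hη0
    ((h.1.mono hb).diffContOnCl_ball (le_refl _)) ?_
  · refine this.trans (le_of_eq ?_)
    field_simp
  · intro v hv
    refine (hK v (hb (sphere_subset_closedBall hv))).trans ?_
    rw [div_le_div_iff₀ (by positivity) (by positivity), mul_assoc]
    refine mul_le_mul_of_nonneg_left ?_ hK0
    have h1 : ‖w‖ ≤ ‖v‖ + η := by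
      have : ‖w‖ ≤ ‖v‖ + ‖w - v‖ := by
        have := norm_add_le v (w - v); simpa using this
      rw [mem_sphere, dist_eq_norm, norm_sub_rev] at hv
      linarith
    have h2 : ‖w‖ ^ 2 ≤ (‖v‖ + η) ^ 2 := by gcongr
    nlinarith [sq_nonneg (‖v‖ - η), sq_nonneg (‖v‖ * η)]

/-- The shrinking width is harmless: a wedge of any positive width and slope `C` contains the lines
`t ℝ` with `t ∈ openSector C`. -/
lemma iterate_deriv (hρ : 0 < ρ) (hC : 0 ≤ C) (h : WedgeDecay ρ C g) (n : ℕ) :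
    WedgeDecay (ρ / 2 ^ n) C (_root_.deriv^[n] g) := by
  induction n with
  | zero => simpa using h
  | succ n ih =>
    rw [Function.iterate_succ_apply', pow_succ, ← div_div]
    exact ih.deriv (by positivity) hC

lemma hasDerivAt_ray (hρ : 0 < ρ) (hC : 0 < C) (h : WedgeDecay ρ C g) {t : ℂ}
    (ht : t ∈ openSector C) (x : ℝ) :
    HasDerivAt (fun x : ℝ => g (t * x)) (t * _root_.deriv g (t * x)) x := by
  have hm := mul_real_mem_wedge hρ hC ht x
  have h1 : HasDerivAt g (_root_.deriv g (t * x)) (t * x) :=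
    (h.1.differentiableAt ((isOpen_wedge _ _).mem_nhds hm)).hasDerivAt
  have h2 : HasDerivAt (fun y : ℂ => t * y) t (x : ℂ) := by
    simpa using (hasDerivAt_id (x : ℂ)).const_mul t
  have h3 := (h1.comp (x : ℂ) h2).comp_ofReal
  rw [mul_comm t]
  exact h3

lemma continuous_ray (hρ : 0 < ρ) (hC : 0 < C) (h : WedgeDecay ρ C g) {t : ℂ}
    (ht : t ∈ openSector C) : Continuous (fun x : ℝ => g (t * x)) :=
  continuous_iff_continuousAt.2 fun x => (h.hasDerivAt_ray hρ hC ht x).continuousAt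

lemma iteratedDeriv_ray (hρ : 0 < ρ) (hC : 0 < C) (h : WedgeDecay ρ C g) {t : ℂ}
    (ht : t ∈ openSector C) (n : ℕ) :
    iteratedDeriv n (fun x : ℝ => g (t * x)) =
      fun x : ℝ => t ^ n * (_root_.deriv^[n] g) (t * x) := by
  induction n with
  | zero => simp
  | succ n ih =>
    rw [iteratedDeriv_succ, ih]
    funext x
    have := ((h.iterate_deriv hρ hC.le n).hasDerivAt_ray (by positivity) hC ht x).const_mul (t ^ n)
    rw [this.deriv, Function.iterate_succ_apply']
    ring

lemma contDiff_ray (hρ : 0 < ρ) (hC : 0 < C) (h : WedgeDecay ρ C g) {t : ℂ}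
    (ht : t ∈ openSector C) (N : ℕ∞) : ContDiff ℝ N (fun x : ℝ => g (t * x)) := by
  refine contDiff_of_differentiable_iteratedDeriv fun n _ => ?_
  rw [h.iteratedDeriv_ray hρ hC ht]
  exact fun x => (((h.iterate_deriv hρ hC.le n).hasDerivAt_ray (by positivity) hC ht x).const_mul
    (t ^ n)).differentiableAt

end WedgeDecay

lemma integrable_one_add_mul_sq (K : ℝ) {m : ℝ} (hm : 0 < m) :
    Integrable (fun x : ℝ => K / (1 + m ^ 2 * x ^ 2)) := by
  have h := ((integrable_inv_one_add_sq.comp_mul_left' hm.ne').const_mul K)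
  refine h.congr (Eventually.of_forall fun x => ?_)
  simp only [mul_pow]
  rfl

lemma integral_one_add_mul_sq (K : ℝ) {m : ℝ} (hm : 0 < m) :
    ∫ x : ℝ, K / (1 + m ^ 2 * x ^ 2) = K * Real.pi / m := by
  have h := Measure.integral_comp_mul_left (fun x : ℝ => (1 + x ^ 2)⁻¹) m
  rw [integral_univ_inv_one_add_sq, abs_of_pos (inv_pos.2 hm), smul_eq_mul] at h
  simp only [div_eq_mul_inv, ← mul_pow, integral_const_mul, h]
  ring

namespace WedgeDecay

variable {ρ C : ℝ} {g : ℂ → ℂ}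

lemma norm_ray_le {K : ℝ} (hρ : 0 < ρ) (hC : 0 < C)
    (hK : ∀ w ∈ wedge ρ C, ‖g w‖ ≤ K / (1 + ‖w‖ ^ 2)) {t : ℂ}
    (ht : t ∈ openSector C) (x : ℝ) : ‖g (t * x)‖ ≤ K / (1 + ‖t‖ ^ 2 * x ^ 2) := by
  have := hK _ (mul_real_mem_wedge hρ hC ht x)
  rwa [norm_mul, mul_pow, Complex.norm_real, Real.norm_eq_abs, sq_abs] at this

lemma integrable_ray (hρ : 0 < ρ) (hC : 0 < C) (h : WedgeDecay ρ C g) {t : ℂ}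
    (ht : t ∈ openSector C) : Integrable (fun x : ℝ => g (t * x)) := by
  obtain ⟨K, hK0, hK⟩ := h.exists_bound
  have ht0 : 0 < ‖t‖ := norm_pos_iff.2 (ne_zero_of_mem_openSector ht)
  exact (integrable_one_add_mul_sq K ht0).mono' (h.continuous_ray hρ hC ht).aestronglyMeasurable
    (Eventually.of_forall fun x => norm_ray_le hρ hC hK ht x)

lemma norm_integral_ray_le {K : ℝ} (hρ : 0 < ρ) (hC : 0 < C)
    (hK : ∀ w ∈ wedge ρ C, ‖g w‖ ≤ K / (1 + ‖w‖ ^ 2)) {t : ℂ}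
    (ht : t ∈ openSector C) : ∫ x : ℝ, ‖g (t * x)‖ ≤ K * Real.pi / ‖t‖ := by
  have ht0 : 0 < ‖t‖ := norm_pos_iff.2 (ne_zero_of_mem_openSector ht)
  rw [← integral_one_add_mul_sq K ht0]
  exact integral_mono_of_nonneg (Eventually.of_forall fun x => norm_nonneg _)
    (integrable_one_add_mul_sq K ht0) (Eventually.of_forall fun x => norm_ray_le hρ hC hK ht x)

open FourierTransform in
/-- Decay of the Fourier transform along a ray. -/
lemma norm_fourier_ray_le (hρ : 0 < ρ) (hC : 0 < C) (h : WedgeDecay ρ C g) (n : ℕ) :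
    ∃ K : ℝ, 0 ≤ K ∧ ∀ t ∈ openSector C, ∀ ξ : ℝ, ξ ≠ 0 →
      ‖𝓕 (fun x : ℝ => g (t * x)) ξ‖ ≤ K * ‖t‖ ^ n / ‖t‖ * (|ξ| ^ n)⁻¹ := by
  have hd := h.iterate_deriv hρ hC.le
  obtain ⟨K, hK0, hK⟩ := (hd n).exists_bound
  refine ⟨K * Real.pi, by positivity, fun t ht ξ hξ => ?_⟩
  have ht0 : 0 < ‖t‖ := norm_pos_iff.2 (ne_zero_of_mem_openSector ht)
  have hint : ∀ k : ℕ, Integrable (iteratedDeriv k (fun x : ℝ => g (t * x))) := by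
    intro k
    rw [h.iteratedDeriv_ray hρ hC ht]
    exact ((hd k).integrable_ray (by positivity) hC ht).const_mul _
  -- Differentiating `n` times multiplies the transform by `(2πiξ)ⁿ`. The chain rule contributes
  -- `tⁿ` and the `L¹` norm along the ray a factor `1 / ‖t‖`, so the constant is uniform in `t`.
  have hF := congrFun (Real.fourier_iteratedDeriv (N := n) (n := n) (h.contDiff_ray hρ hC ht n)
    (fun k _ => hint k) le_rfl) ξ
  have hle : ‖𝓕 (iteratedDeriv n (fun x : ℝ => g (t * x))) ξ‖ ≤ ‖t‖ ^ n * (K * Real.pi / ‖t‖) := by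
    refine (VectorFourier.norm_fourierIntegral_le_integral_norm _ _ _ _ _).trans ?_
    rw [h.iteratedDeriv_ray hρ hC ht]
    simp only [norm_mul, norm_pow]
    rw [integral_const_mul]
    exact mul_le_mul_of_nonneg_left (norm_integral_ray_le (by positivity) hC hK ht) (by positivity)
  rw [hF, norm_smul, norm_pow] at hle
  have h2 : |ξ| ≤ ‖(2 * Real.pi * Complex.I * ξ : ℂ)‖ := by
    simp only [norm_mul, Complex.norm_I, Complex.norm_real, Real.norm_eq_abs, Complex.norm_ofNat,
      abs_of_pos Real.pi_pos]
    nlinarith [abs_nonneg ξ, Real.pi_gt_three]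
  have hξ0 : 0 < |ξ| := abs_pos.2 hξ
  rw [← div_eq_mul_inv, le_div_iff₀ (by positivity)]
  calc _ = |ξ| ^ n * ‖𝓕 (fun x : ℝ => g (t * x)) ξ‖ := mul_comm _ _
    _ ≤ _ := mul_le_mul_of_nonneg_right (pow_le_pow_left₀ hξ0.le h2 n) (norm_nonneg _)
    _ ≤ _ := hle
    _ = _ := by ring

end WedgeDecay

/-! ### Independence of the ray and Poisson summation. -/

namespace WedgeDecay

variable {ρ C : ℝ} {g : ℂ → ℂ}

/-- The `t`-derivative of the integrand contains `x * g' (t x)`, which quadratic decay of `g'` would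
bound only by a multiple of `1 / |x|`. Cauchy's estimate in the variable `t` instead transfers the
quadratic decay of `g` and gives an integrable bound. -/
lemma differentiableAt_integral_ray (hρ : 0 < ρ) (hC : 0 < C) (h : WedgeDecay ρ C g) {t₀ : ℂ}
    (ht₀ : t₀ ∈ openSector C) :
    DifferentiableAt ℂ (fun t : ℂ => ∫ x : ℝ, t * g (t * x)) t₀ := by
  obtain ⟨K, hK0, hK⟩ := h.exists_bound
  have hn : 0 < ‖t₀‖ := norm_pos_iff.2 (ne_zero_of_mem_openSector ht₀)
  obtain ⟨δ, hδ, hball⟩ := Metric.isOpen_iff.1 (isOpen_openSector C) t₀ ht₀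
  -- Discs of radius `ε` about points of `ball t₀ ε` stay within `2 ε` of `t₀`: inside the sector,
  -- and with `‖t₀‖ / 2 ≤ ‖v‖ ≤ 2 ‖t₀‖`.
  set ε := min (δ / 4) (‖t₀‖ / 4) with hε
  have hε0 : 0 < ε := by positivity
  have hε1 : ε ≤ δ / 4 := min_le_left _ _
  have hε2 : ε ≤ ‖t₀‖ / 4 := min_le_right _ _
  set m := ‖t₀‖ / 2 with hm
  have hm0 : 0 < m := by positivity
  have hder : ∀ t ∈ openSector C, ∀ x : ℝ, HasDerivAt (fun t : ℂ => t * g (t * x))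
      (g (t * x) + t * (_root_.deriv g (t * x) * x)) t := by
    intro t ht x
    have hmem := mul_real_mem_wedge hρ hC ht x
    have h1 : HasDerivAt g (_root_.deriv g (t * x)) (t * x) :=
      (h.1.differentiableAt ((isOpen_wedge _ _).mem_nhds hmem)).hasDerivAt
    have h2 : HasDerivAt (fun t : ℂ => t * x) (x : ℂ) t := by
      simpa using (hasDerivAt_id t).mul_const (x : ℂ)
    have h3 := (hasDerivAt_id t).mul (h1.comp t h2)
    simp only [one_mul, id] at h3
    exact h3
  have hmem : ∀ t ∈ ball t₀ ε, closedBall t ε ⊆ openSector C := by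
    intro t ht v hv
    apply hball
    rw [mem_ball] at ht ⊢
    rw [mem_closedBall] at hv
    linarith [dist_triangle v t t₀]
  have hbound : ∀ x : ℝ, ∀ t ∈ ball t₀ ε, ‖g (t * x) + t * (_root_.deriv g (t * x) * x)‖ ≤
      (2 * ‖t₀‖ * K / ε) / (1 + m ^ 2 * x ^ 2) := by
    intro x t ht
    rw [← (hder t (hmem t ht (mem_closedBall_self hε0.le)) x).deriv]
    refine (Complex.norm_deriv_le_of_forall_mem_sphere_norm_le
      (C := 2 * ‖t₀‖ * (K / (1 + m ^ 2 * x ^ 2))) hε0 ?_ ?_).trans (le_of_eq ?_)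
    · refine DifferentiableOn.diffContOnCl_ball (U := openSector C) ?_ (hmem t ht)
      exact fun v hv => (hder v hv x).differentiableAt.differentiableWithinAt
    · intro v hv
      have hvS := hmem t ht (sphere_subset_closedBall hv)
      rw [mem_sphere] at hv
      rw [mem_ball] at ht
      have hd : ‖v - t₀‖ ≤ ‖t₀‖ / 2 := by
        rw [← dist_eq_norm]
        linarith [dist_triangle v t t₀]
      have h1 : ‖v‖ ≤ 2 * ‖t₀‖ := by
        have := norm_add_le t₀ (v - t₀)
        simp only [add_sub_cancel] at this
        linarith
      have h2 : m ≤ ‖v‖ := by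
        have := norm_sub_norm_le t₀ v
        rw [norm_sub_rev] at this
        linarith
      rw [norm_mul]
      refine mul_le_mul h1 ((norm_ray_le hρ hC hK hvS x).trans ?_) (norm_nonneg _) (by positivity)
      gcongr
    · field_simp
  have hmeas : ∀ t ∈ openSector C, AEStronglyMeasurable (fun x : ℝ => t * g (t * x)) volume :=
    fun t ht => (continuous_const.mul (h.continuous_ray hρ hC ht)).aestronglyMeasurable
  refine (hasDerivAt_integral_of_dominated_loc_of_deriv_le (ball_mem_nhds t₀ hε0) ?_ ?_ ?_
    (Eventually.of_forall hbound) (integrable_one_add_mul_sq _ hm0)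
    (Eventually.of_forall fun x t ht => hder t (hmem t ht (mem_closedBall_self hε0.le)) x)).2.differentiableAt
  · filter_upwards [(isOpen_openSector C).mem_nhds ht₀] with t ht using hmeas t ht
  · exact (h.integrable_ray hρ hC ht₀).const_mul _
  · have hc := (h.deriv hρ hC.le).continuous_ray (by positivity) hC ht₀
    exact ((h.continuous_ray hρ hC ht₀).add (continuous_const.mul
      (hc.mul Complex.continuous_ofReal))).aestronglyMeasurable

/-- The integral of a function with decay in a wedge does not depend on the ray. -/
lemma exists_integral_ray_eq (hρ : 0 < ρ) (hC : 0 < C) (h : WedgeDecay ρ C g) :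
    ∃ I : ℂ, ∀ t ∈ openSector C, ∫ x : ℝ, g (t * x) = I / t := by
  set J : ℂ → ℂ := fun t : ℂ => ∫ x : ℝ, t * g (t * x) with hJ
  have hdiff : ∀ t ∈ openSector C, DifferentiableAt ℂ J t :=
    fun t ht => h.differentiableAt_integral_ray hρ hC ht
  -- Rescaling `x` shows that `J` is homogeneous of degree `0`. Its radial derivative `t J'(t)`
  -- therefore vanishes, and `J` is constant on the connected sector, without any deformation of
  -- contours.
  have hscale : ∀ t : ℂ, ∀ s : ℝ, 0 < s → J (t * s) = J t := by
    intro t s hs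
    have := Measure.integral_comp_mul_left (fun x : ℝ => t * g (t * x)) s
    simp only [hJ]
    simp only [Complex.ofReal_mul, abs_of_pos (inv_pos.2 hs)] at this
    have hs' : (s : ℂ) ≠ 0 := Complex.ofReal_ne_zero.2 hs.ne'
    calc (∫ x : ℝ, t * s * g (t * s * x)) = s * ∫ x : ℝ, t * g (t * (s * x)) := by
          rw [← integral_const_mul]
          congr 1
          funext x
          ring_nf
      _ = _ := by
          rw [this, Complex.real_smul, ← mul_assoc, Complex.ofReal_inv, mul_inv_cancel₀ hs', one_mul]
  have hzero : ∀ t ∈ openSector C, _root_.deriv J t = 0 := by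
    intro t ht
    have h1 : HasDerivAt J (_root_.deriv J t) (t * (1 : ℝ)) := by
      simpa using (hdiff t ht).hasDerivAt
    have h2 : HasDerivAt (fun y : ℂ => t * y) t ((1 : ℝ) : ℂ) := by
      simpa using (hasDerivAt_id ((1 : ℝ) : ℂ)).const_mul t
    have h3 : HasDerivAt (fun s : ℝ => J (t * s)) (_root_.deriv J t * t) 1 :=
      (h1.comp _ h2).comp_ofReal
    have h4 : HasDerivAt (fun s : ℝ => J (t * s)) 0 1 := by
      refine (hasDerivAt_const (1 : ℝ) (J t)).congr_of_eventuallyEq ?_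
      filter_upwards [lt_mem_nhds (zero_lt_one' ℝ)] with s hs using hscale t s hs
    exact (mul_eq_zero.1 (h3.unique h4)).resolve_right (ne_zero_of_mem_openSector ht)
  obtain ⟨I, hI⟩ := (isOpen_openSector C).exists_is_const_of_deriv_eq_zero
    (convex_openSector C).isPreconnected
    (fun t ht => (hdiff t ht).differentiableWithinAt) (fun t ht => hzero t ht)
  refine ⟨I, fun t ht => ?_⟩
  rw [eq_div_iff (ne_zero_of_mem_openSector ht), ← hI t ht, hJ]
  simp only [integral_const_mul]
  ring

lemma summable_ray (hρ : 0 < ρ) (hC : 0 < C) (h : WedgeDecay ρ C g) {t : ℂ}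
    (ht : t ∈ openSector C) : Summable fun n : ℕ => g ((n + 1 : ℕ) * t) := by
  obtain ⟨K, hK0, hK⟩ := h.exists_bound
  have ht0 : 0 < ‖t‖ := norm_pos_iff.2 (ne_zero_of_mem_openSector ht)
  have hs := ((summable_nat_add_iff 1).2
    (Real.summable_nat_pow_inv.2 one_lt_two)).mul_left (K / ‖t‖ ^ 2)
  refine Summable.of_norm_bounded hs fun n => ?_
  have := norm_ray_le hρ hC hK ht ((n + 1 : ℕ) : ℝ)
  rw [mul_comm, ← Complex.ofReal_natCast]
  refine this.trans ?_
  rw [← div_eq_mul_inv, div_div]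
  gcongr
  linarith

open FourierTransform in
/-- The Euler-Maclaurin asymptotics of `∑ g (n t)`, `n ≥ 1`, as `t → 0` in a sector, for an even
function `g`. -/
theorem exists_norm_tsum_sub_le (hρ : 0 < ρ) (hC : 0 < C) (h : WedgeDecay ρ C g)
    (heven : ∀ w, g (-w) = g w) :
    ∃ I : ℂ, ∀ N : ℕ, ∃ K : ℝ, ∀ t ∈ openSector C,
      ‖∑' n : ℕ, g ((n + 1 : ℕ) * t) - (I / t - g 0 / 2)‖ ≤ K * ‖t‖ ^ (N + 1) := by
  obtain ⟨I, hI⟩ := h.exists_integral_ray_eq hρ hC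
  -- Here `I` belongs to the integral over the whole line, whereas the sum runs over `n ≥ 1` only.
  refine ⟨I / 2, fun N => ?_⟩
  -- Decay of order `2` justifies Poisson summation; order `N + 2` yields `‖t‖ ^ (N + 2) / ‖t‖`, the
  -- claimed error.
  obtain ⟨K2, hK20, hK2⟩ := h.norm_fourier_ray_le hρ hC 2
  obtain ⟨K, hK0, hK⟩ := h.norm_fourier_ray_le hρ hC (N + 1 + 1)
  obtain ⟨B, hB0, hB⟩ := h.exists_bound
  set Z : ℝ := ∑' n : ℕ, (|((n + 1 : ℕ) : ℝ)| ^ (N + 1 + 1))⁻¹ with hZ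
  have hZs : Summable fun n : ℕ => (|((n + 1 : ℕ) : ℝ)| ^ (N + 1 + 1))⁻¹ := by
    simp only [Nat.abs_cast]
    exact (summable_nat_add_iff 1).2 (Real.summable_nat_pow_inv.2 (by omega))
  refine ⟨K * Z, fun t ht => ?_⟩
  have ht0 : 0 < ‖t‖ := norm_pos_iff.2 (ne_zero_of_mem_openSector ht)
  set f : ℝ → ℂ := fun x => g (t * x) with hf
  have hrpow : ∀ x : ℝ, |x| ^ (-2 : ℝ) = (|x| ^ 2)⁻¹ := fun x => by
    rw [Real.rpow_neg (abs_nonneg x)]; norm_cast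
  have hne : ∀ᶠ x : ℝ in cocompact ℝ, x ≠ 0 := by
    have : ({0} : Set ℝ)ᶜ ∈ cocompact ℝ := isCompact_singleton.compl_mem_cocompact
    exact this
  have hP := Real.tsum_eq_tsum_fourier_of_rpow_decay (h.continuous_ray hρ hC ht) one_lt_two
    (IsBigO.of_bound (B / ‖t‖ ^ 2) (by
      filter_upwards [hne] with x hx
      refine (norm_ray_le hρ hC hB ht x).trans ?_
      rw [hrpow, norm_inv, norm_pow, Real.norm_eq_abs, abs_abs, sq_abs, ← div_eq_mul_inv, div_div]
      gcongr
      linarith))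
    (IsBigO.of_bound (K2 * ‖t‖ ^ 2 / ‖t‖) (by
      filter_upwards [hne] with x hx
      refine (hK2 t ht x hx).trans ?_
      rw [hrpow, norm_inv, norm_pow, Real.norm_eq_abs, abs_abs])) 0
  simp only [zero_add, QuotientAddGroup.mk_zero, fourier_eval_zero, mul_one] at hP
  have hs := h.summable_ray hρ hC ht
  have hcast : ∀ n : ℕ, f (((n : ℤ) + 1 : ℤ) : ℝ) = g ((n + 1 : ℕ) * t) := by
    intro n; simp [hf, mul_comm]
  have hcast' : ∀ n : ℕ, f ((-((n : ℤ) + 1) : ℤ) : ℝ) = g ((n + 1 : ℕ) * t) := by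
    intro n
    rw [← heven]; simp only [hf]
    congr 1
    push_cast
    ring
  have hL : ∑' n : ℤ, f n = g 0 + 2 * ∑' n : ℕ, g ((n + 1 : ℕ) * t) := by
    rw [tsum_of_add_one_of_neg_add_one (f := fun n : ℤ => f n)]
    · simp only [hcast, hcast']
      simp [hf]; ring
    · simpa only [hcast] using hs
    · simpa only [hcast'] using hs
  have hb1 : ∀ n : ℕ, ‖𝓕 f (((n : ℤ) + 1 : ℤ) : ℝ)‖ ≤
      K * ‖t‖ ^ (N + 1) * (|((n + 1 : ℕ) : ℝ)| ^ (N + 1 + 1))⁻¹ := by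
    intro n
    have hx : (((n : ℤ) + 1 : ℤ) : ℝ) = ((n + 1 : ℕ) : ℝ) := by push_cast; ring
    rw [hx]
    refine (hK t ht _ (by positivity)).trans (le_of_eq ?_)
    rw [pow_succ ‖t‖ (N + 1)]
    field_simp
  have hb2 : ∀ n : ℕ, ‖𝓕 f ((-((n : ℤ) + 1) : ℤ) : ℝ)‖ ≤
      K * ‖t‖ ^ (N + 1) * (|((n + 1 : ℕ) : ℝ)| ^ (N + 1 + 1))⁻¹ := by
    intro n
    have hx : ((-((n : ℤ) + 1) : ℤ) : ℝ) = -((n + 1 : ℕ) : ℝ) := by push_cast; ring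
    rw [hx]
    refine (hK t ht _ (neg_ne_zero.2 (by positivity))).trans (le_of_eq ?_)
    rw [abs_neg, pow_succ ‖t‖ (N + 1)]
    field_simp
  have hs1 := hZs.mul_left (K * ‖t‖ ^ (N + 1))
  have hR : ∑' n : ℤ, 𝓕 f n = I / t + (∑' n : ℕ, 𝓕 f (((n : ℤ) + 1 : ℤ) : ℝ)
      + ∑' n : ℕ, 𝓕 f ((-((n : ℤ) + 1) : ℤ) : ℝ)) := by
    rw [tsum_of_add_one_of_neg_add_one (f := fun n : ℤ => 𝓕 f n)
      (Summable.of_norm_bounded hs1 hb1) (Summable.of_norm_bounded hs1 hb2)]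
    have : 𝓕 f ((0 : ℤ) : ℝ) = I / t := by
      rw [← hI t ht, Real.fourier_eq]
      simp [hf]
    rw [this]; ring
  change ∑' n : ℤ, f n = ∑' n : ℤ, 𝓕 f n at hP
  rw [hL, hR] at hP
  -- The zero frequency is the integral and evenness has folded the left side, so the whole error
  -- consists of the nonzero frequencies.
  have hkey : ∑' n : ℕ, g ((n + 1 : ℕ) * t) - (I / 2 / t - g 0 / 2) =
      (∑' n : ℕ, 𝓕 f (((n : ℤ) + 1 : ℤ) : ℝ) + ∑' n : ℕ, 𝓕 f ((-((n : ℤ) + 1) : ℤ) : ℝ)) / 2 := by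
    linear_combination hP / 2
  rw [hkey, norm_div, Complex.norm_ofNat, div_le_iff₀ two_pos]
  have e1 := tsum_of_norm_bounded hs1.hasSum hb1
  have e2 := tsum_of_norm_bounded hs1.hasSum hb2
  rw [tsum_mul_left, ← hZ] at e1 e2
  refine (norm_add_le _ _).trans ((add_le_add e1 e2).trans (le_of_eq ?_))
  ring

end WedgeDecay

/-! ### Bounds for `sinh² (w / 2)` and `cosh² (w / 2)` on a wedge. -/

/-- `sinh² (w / 2)`. -/
noncomputable def sinhHalfSq (w : ℂ) : ℂ := (Complex.cosh w - 1) / 2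

/-- `cosh² (w / 2)`. -/
noncomputable def coshHalfSq (w : ℂ) : ℂ := (Complex.cosh w + 1) / 2

lemma normSq_cosh_add (w : ℂ) (e : ℝ) (he : e ^ 2 = 1) :
    ‖Complex.cosh w + e‖ ^ 2 = (Real.cosh w.re + e * Real.cos w.im) ^ 2 := by
  have hw : Complex.cosh w + e = ((Real.cosh w.re * Real.cos w.im + e : ℝ) : ℂ)
      + ((Real.sinh w.re * Real.sin w.im : ℝ) : ℂ) * Complex.I := by
    conv_lhs => rw [← Complex.re_add_im w, Complex.cosh_add, Complex.cosh_mul_I,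
      Complex.sinh_mul_I]
    push_cast
    ring
  rw [hw, Complex.sq_norm, Complex.normSq_add_mul_I]
  have h1 := Real.cosh_sq w.re
  have h2 := Real.sin_sq_add_cos_sq w.im
  have h3 : Real.sinh w.re ^ 2 = Real.cosh w.re ^ 2 - 1 := by linarith
  have h4 : Real.sin w.im ^ 2 = 1 - Real.cos w.im ^ 2 := by linarith
  rw [mul_pow, h3, h4]
  linear_combination (1 - Real.cos w.im ^ 2) * he

lemma norm_sinhHalfSq (w : ℂ) :
    ‖sinhHalfSq w‖ = (Real.cosh w.re - Real.cos w.im) / 2 := by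
  have h := normSq_cosh_add w (-1) (by norm_num)
  have h0 : 0 ≤ Real.cosh w.re + (-1) * Real.cos w.im := by
    linarith [Real.one_le_cosh w.re, Real.cos_le_one w.im]
  have := (pow_left_inj₀ (norm_nonneg _) h0 two_ne_zero).1 h
  rw [sinhHalfSq, norm_div, Complex.norm_ofNat]
  push_cast at this
  rw [sub_eq_add_neg, this]
  ring

lemma norm_coshHalfSq (w : ℂ) :
    ‖coshHalfSq w‖ = (Real.cosh w.re + Real.cos w.im) / 2 := by
  have h := normSq_cosh_add w 1 (by norm_num)
  have h0 : 0 ≤ Real.cosh w.re + 1 * Real.cos w.im := by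
    linarith [Real.one_le_cosh w.re, Real.neg_one_le_cos w.im]
  have := (pow_left_inj₀ (norm_nonneg _) h0 two_ne_zero).1 h
  rw [coshHalfSq, norm_div, Complex.norm_ofNat]
  push_cast at this
  rw [this]
  ring

lemma one_add_sq_div_two_le_cosh (x : ℝ) : 1 + x ^ 2 / 2 ≤ Real.cosh x := by
  have h := Real.cosh_two_mul (x / 2)
  have h1 := Real.cosh_sq (x / 2)
  have h2 : (x / 2) ^ 2 ≤ Real.sinh (x / 2) ^ 2 := by
    rw [← sq_abs, ← sq_abs (Real.sinh _), Real.abs_sinh]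
    exact pow_le_pow_left₀ (abs_nonneg _) (Real.self_le_sinh_iff.2 (abs_nonneg _)) 2
  rw [mul_div_cancel₀ x two_ne_zero] at h
  nlinarith

/-- Width `1` keeps the wedge away from the zeros of `cosh (w/2)` and from those of `sinh (w/2)`
other than `0`. For `|Re w| ≤ b` the imaginary part is below `9/8 < π/2`, which controls the cosine.
For `|Re w| > b` the hyperbolic cosine exceeds `1` by a fixed amount and dominates. -/
lemma exists_wedge_bounds {C : ℝ} (hC : 0 < C) :
    ∃ m > 0, ∀ w ∈ wedge 1 C,
      m * (1 + ‖w‖ ^ 2) ≤ Real.cosh w.re + 1 ∧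
      m * (Real.cosh w.re + 1) ≤ Real.cosh w.re + Real.cos w.im ∧
      (1 / 2 ≤ ‖w‖ → m * (Real.cosh w.re + 1) ≤ Real.cosh w.re - Real.cos w.im) := by
  set b : ℝ := 1 / (8 * (C + 1)) with hb
  have hb0 : 0 < b := by positivity
  have hbC : b * (C + 1) = 1 / 8 := by rw [hb]; field_simp
  have hb1 : b ≤ 1 / 8 := by nlinarith
  set e : ℝ := b ^ 2 / 2 with he
  have he0 : 0 < e := by positivity
  have he1 : e ≤ 1 / 128 := by rw [he]; nlinarith
  -- Chosen so that `m₁ (c + 1) ≤ c - 1` holds exactly when `c ≥ 1 + e`.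
  set m₁ : ℝ := e / (2 + e) with hm₁
  have hm₁0 : 0 < m₁ := by positivity
  have hm₁e : m₁ * (2 + e) = e := by rw [hm₁]; field_simp
  have hm₁1 : m₁ ≤ 1 / 2 := by nlinarith
  set L : ℝ := 3 + 2 * (1 + 2 * C ^ 2) with hL
  have hL0 : 0 < L := by positivity
  refine ⟨min m₁ (1 / L), by positivity, fun w hw => ?_⟩
  have hle1 : min m₁ (1 / L) ≤ m₁ := min_le_left _ _
  have hle2 : min m₁ (1 / L) ≤ 1 / L := min_le_right _ _
  have hw' : |w.im| < 1 + C * |w.re| := hw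
  have hcosh := one_add_sq_div_two_le_cosh w.re
  have hc1 : 0 ≤ Real.cosh w.re + 1 := by linarith [Real.one_le_cosh w.re]
  have hnorm : ‖w‖ ^ 2 = w.re ^ 2 + w.im ^ 2 := by
    rw [Complex.sq_norm, Complex.normSq_apply]; ring
  have hr := abs_nonneg w.re
  have hi := abs_nonneg w.im
  have hr2 := sq_abs w.re
  have hi2 := sq_abs w.im
  have key : ∀ X : ℝ, m₁ * (Real.cosh w.re + 1) ≤ X →
      min m₁ (1 / L) * (Real.cosh w.re + 1) ≤ X := fun X hX =>
    (mul_le_mul_of_nonneg_right hle1 hc1).trans hX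
  have hone := Real.one_le_cosh w.re
  have h5 : m₁ * (Real.cosh w.re - 1) ≤ 1 / 2 * (Real.cosh w.re - 1) :=
    mul_le_mul_of_nonneg_right hm₁1 (by linarith)
  have h6 : 0 ≤ m₁ * e := by positivity
  have h7 : b ^ 2 ≤ w.re ^ 2 → 0 ≤ (1 - m₁) * (Real.cosh w.re - 1 - e) := fun h =>
    mul_nonneg (by linarith) (by linarith)
  have hbC' : ∀ x ≤ b, C * x ≤ 1 / 8 := fun x hx =>
    (mul_le_mul_of_nonneg_left hx hC.le).trans (by linarith)
  refine ⟨?_, key _ ?_, fun hw2 => key _ ?_⟩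
  · refine (mul_le_mul_of_nonneg_right hle2 (by positivity)).trans ?_
    rw [one_div, inv_mul_le_iff₀ hL0, hnorm]
    have : w.im ^ 2 ≤ 2 + 2 * C ^ 2 * w.re ^ 2 := by
      have h1 : |w.im| ^ 2 ≤ (1 + C * |w.re|) ^ 2 := pow_le_pow_left₀ hi hw'.le 2
      nlinarith [sq_nonneg (1 - C * |w.re|)]
    have h2 : L * (2 + w.re ^ 2 / 2) ≤ L * (Real.cosh w.re + 1) :=
      mul_le_mul_of_nonneg_left (by linarith) hL0.le
    have h3 : L * (2 + w.re ^ 2 / 2) = 2 * L + 3 / 2 * w.re ^ 2 + (1 + 2 * C ^ 2) * w.re ^ 2 := by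
      rw [hL]; ring
    linarith [sq_nonneg w.re, sq_nonneg C, sq_nonneg (C * w.re), mul_pow C w.re 2]
  · rcases le_or_gt |w.re| b with h | h
    · have hy : |w.im| ≤ Real.pi / 2 := by
        linarith [Real.pi_gt_three, hbC' _ h]
      have := Real.cos_nonneg_of_mem_Icc (abs_le.1 hy)
      linarith
    · have : b ^ 2 ≤ w.re ^ 2 := by rw [← hr2]; gcongr
      linarith [Real.neg_one_le_cos w.im, h7 this]
  · rcases le_or_gt |w.re| b with h | h
    · have hy : |w.im| ≤ 9 / 8 := by linarith [hbC' _ h]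
      have hx2 : w.re ^ 2 ≤ (1 / 8) ^ 2 := by rw [← hr2]; gcongr; linarith
      have hn : (1 / 2 : ℝ) ^ 2 ≤ ‖w‖ ^ 2 := by gcongr
      -- `15/64 = (1/2)² - (1/8)²`: away from `0` but near the imaginary axis, the imaginary part is
      -- bounded below, so the cosine stays away from `1`.
      have hy2 : 15 / 64 ≤ w.im ^ 2 := by linarith
      have hcos := Real.cos_le_one_sub_mul_cos_sq (hy.trans (by linarith [Real.pi_gt_three]))
      have hpi : 2 / 16 ≤ 2 / Real.pi ^ 2 := by
        rw [show (16 : ℝ) = 4 ^ 2 by norm_num]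
        gcongr
        exact Real.pi_le_four
      have h4 : 2 / 16 * (15 / 64) ≤ 2 / Real.pi ^ 2 * w.im ^ 2 := by gcongr
      linarith
    · have : b ^ 2 ≤ w.re ^ 2 := by rw [← hr2]; gcongr
      linarith [Real.cos_le_one w.im, h7 this]

lemma sinhHalfSq_ne_zero {C : ℝ} {w : ℂ} (hw : w ∈ wedge 1 C) (h0 : w ≠ 0) :
    sinhHalfSq w ≠ 0 := by
  rw [← norm_ne_zero_iff, norm_sinhHalfSq]
  have hw' : |w.im| < 1 + C * |w.re| := hw
  by_cases hx : w.re = 0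
  · have hy : w.im ≠ 0 := fun h => h0 (Complex.ext hx h)
    rw [hx] at hw' ⊢
    simp only [abs_zero, mul_zero, add_zero] at hw'
    have hy1 := abs_lt.1 hw'
    have := Real.cos_le_one_sub_mul_cos_sq (x := w.im) (by linarith [Real.pi_gt_three])
    have : 0 < 2 / Real.pi ^ 2 * w.im ^ 2 := by positivity
    rw [Real.cosh_zero]
    linarith
  · have := Real.one_lt_cosh.2 hx
    linarith [Real.cos_le_one w.im]

/-- Bounds for `1 / sinh²` and `1 / cosh²` of `w / 2` on a wedge. -/
lemma exists_inv_bounds {C : ℝ} (hC : 0 < C) :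
    ∃ K > 0, ∀ w ∈ wedge 1 C,
      coshHalfSq w ≠ 0 ∧ ‖(coshHalfSq w)⁻¹‖ ≤ K / (1 + ‖w‖ ^ 2) ∧
      ‖sinhHalfSq w / coshHalfSq w‖ ≤ K ∧
      (1 / 2 ≤ ‖w‖ → ‖(sinhHalfSq w)⁻¹‖ ≤ K / (1 + ‖w‖ ^ 2)) := by
  obtain ⟨m, hm, h⟩ := exists_wedge_bounds hC
  refine ⟨2 / m ^ 2 + 1 / m, by positivity, fun w hw => ?_⟩
  obtain ⟨h1, h2, h3⟩ := h w hw
  have hp : 0 < 1 + ‖w‖ ^ 2 := by positivity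
  have hco : 0 < Real.cosh w.re + 1 := by linarith [Real.one_le_cosh w.re]
  have hinv : ∀ X : ℝ, m * (Real.cosh w.re + 1) ≤ X →
      (X / 2)⁻¹ ≤ (2 / m ^ 2 + 1 / m) / (1 + ‖w‖ ^ 2) := by
    intro X hX
    have hX2 : m ^ 2 * (1 + ‖w‖ ^ 2) ≤ X := by nlinarith
    calc (X / 2)⁻¹ ≤ (m ^ 2 * (1 + ‖w‖ ^ 2) / 2)⁻¹ := by gcongr
      _ = (2 / m ^ 2) / (1 + ‖w‖ ^ 2) := by field_simp
      _ ≤ _ := by gcongr; linarith [one_div_pos.2 hm]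
  have hpos : 0 < Real.cosh w.re + Real.cos w.im := lt_of_lt_of_le (by positivity) h2
  refine ⟨?_, ?_, ?_, fun hw2 => ?_⟩
  · rw [← norm_ne_zero_iff, norm_coshHalfSq]
    positivity
  · rw [norm_inv, norm_coshHalfSq]
    exact hinv _ h2
  · rw [norm_div, norm_coshHalfSq, norm_sinhHalfSq, div_div_div_cancel_right₀ two_ne_zero]
    calc _ ≤ 1 / m := by
          rw [div_le_div_iff₀ hpos hm]
          nlinarith [Real.neg_one_le_cos w.im]
      _ ≤ _ := by linarith [show 0 < 2 / m ^ 2 by positivity]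
  · rw [norm_inv, norm_sinhHalfSq]
    exact hinv _ (h3 hw2)

lemma differentiable_sinhHalfSq : Differentiable ℂ sinhHalfSq := by
  unfold sinhHalfSq; fun_prop

lemma differentiable_coshHalfSq : Differentiable ℂ coshHalfSq := by
  unfold coshHalfSq; fun_prop

/-- Up to numerical factors, these are the coefficients of the expansion of `(1 + (1 + q) sinh²
(w/2))⁻¹ ^ (j + 1)` in powers of `q = r² κ²`. -/
lemma wedgeDecay_inv_coshHalfSq_pow {C : ℝ} (hC : 0 < C) (j k : ℕ) :
    WedgeDecay 1 C fun w => (coshHalfSq w)⁻¹ ^ (j + 1) * (sinhHalfSq w / coshHalfSq w) ^ k := by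
  obtain ⟨K, hK, h⟩ := exists_inv_bounds hC
  refine ⟨fun w hw => ?_, K ^ (j + 1) * K ^ k, fun w hw => ?_⟩
  · have h0 := (h w hw).1
    have h1 := differentiable_sinhHalfSq w
    have h2 := differentiable_coshHalfSq w
    exact (((h2.inv h0).pow _).mul ((h1.div h2 h0).pow _)).differentiableWithinAt
  · obtain ⟨-, h1, h2, -⟩ := h w hw
    rw [norm_mul, norm_pow, norm_pow]
    have hp : 1 ≤ 1 + ‖w‖ ^ 2 := by linarith [sq_nonneg ‖w‖]
    have h3 : ‖(coshHalfSq w)⁻¹‖ ≤ K := h1.trans (div_le_self hK.le hp)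
    calc _ ≤ (K ^ j * (K / (1 + ‖w‖ ^ 2))) * K ^ k := by
          rw [pow_succ]
          gcongr
      _ = _ := by ring

/-- The singularity at `0` is removable; on the disc `‖w‖ ≤ 1/2` compactness replaces the decay
estimate, since there `1 + ‖w‖² ≤ 2`. -/
lemma wedgeDecay_update {C : ℝ} (hC : 0 < C) {f : ℂ → ℂ} {l : ℂ}
    (hd : ∀ w ∈ wedge 1 C, w ≠ 0 → DifferentiableAt ℂ f w)
    (hl : Tendsto f (𝓝[≠] 0) (𝓝 l)) {K : ℝ}
    (hK : ∀ w ∈ wedge 1 C, 1 / 2 ≤ ‖w‖ → ‖f w‖ ≤ K / (1 + ‖w‖ ^ 2)) :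
    WedgeDecay 1 C (Function.update f 0 l) := by
  have hdiff : DifferentiableOn ℂ (Function.update f 0 l) (wedge 1 C) := by
    rw [← Complex.differentiableOn_compl_singleton_and_continuousAt_iff
      ((isOpen_wedge 1 C).mem_nhds (zero_mem_wedge one_pos))]
    refine ⟨fun w hw => ?_, continuousAt_update_same.2 hl⟩
    refine ((hd w hw.1 hw.2).congr_of_eventuallyEq ?_).differentiableWithinAt
    filter_upwards [isOpen_ne.mem_nhds hw.2] with v hv
    exact Function.update_of_ne hv _ _
  refine ⟨hdiff, ?_⟩
  have hsub : closedBall (0 : ℂ) (1 / 2) ⊆ wedge 1 C := by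
    intro w hw
    rw [mem_closedBall, dist_zero_right] at hw
    show |w.im| < 1 + C * |w.re|
    have := Complex.abs_im_le_norm w
    nlinarith [abs_nonneg w.re]
  obtain ⟨M, hM⟩ := (isCompact_closedBall (0 : ℂ) (1 / 2)).exists_bound_of_continuousOn
    (hdiff.continuousOn.mono hsub)
  refine ⟨max K (2 * M), fun w hw => ?_⟩
  rcases le_total (1 / 2) ‖w‖ with h | h
  · have h0 : w ≠ 0 := by rintro rfl; norm_num at h
    rw [Function.update_of_ne h0]
    refine (hK w hw h).trans ?_
    gcongr
    exact le_max_left _ _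
  · have h1 := hM w (by simpa using h)
    have hM0 : 0 ≤ M := (norm_nonneg _).trans h1
    rw [le_div_iff₀ (by positivity)]
    calc _ ≤ M * 2 := by
          gcongr
          nlinarith [norm_nonneg w]
      _ ≤ _ := by rw [mul_comm]; exact le_max_right _ _

/-! ### Laurent expansions at `0` and removal of the principal parts. -/

/-- The normalized remainder of the Taylor expansion of `sinh² (w / 2)`. -/
noncomputable def sinhRem (w : ℂ) : ℂ := (4 * sinhHalfSq w / w ^ 2 - 1 - w ^ 2 / 12) / w ^ 4

lemma sinhHalfSq_eq {w : ℂ} (hw : w ≠ 0) :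
    sinhHalfSq w = w ^ 2 / 4 * (1 + w ^ 2 / 12 + w ^ 4 * sinhRem w) := by
  rw [sinhRem]; field_simp; ring

lemma norm_cosh_sub_taylor_le {w : ℂ} (hw : ‖w‖ ≤ 1) :
    ‖Complex.cosh w - (1 + w ^ 2 / 2 + w ^ 4 / 24 + w ^ 6 / 720)‖ ≤ ‖w‖ ^ 8 := by
  have h1 := Complex.exp_bound hw (n := 8) (by norm_num)
  have h2 := Complex.exp_bound (x := -w) (by simpa using hw) (n := 8) (by norm_num)
  have e : Complex.cosh w - (1 + w ^ 2 / 2 + w ^ 4 / 24 + w ^ 6 / 720) =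
      ((Complex.exp w - ∑ m ∈ Finset.range 8, w ^ m / (m.factorial : ℂ)) +
      (Complex.exp (-w) - ∑ m ∈ Finset.range 8, (-w) ^ m / (m.factorial : ℂ))) / 2 := by
    rw [Complex.cosh]
    simp only [Finset.sum_range_succ, Finset.sum_range_zero, Nat.factorial]
    push_cast
    ring
  rw [e, norm_div, Complex.norm_ofNat, div_le_iff₀ two_pos]
  refine (norm_add_le _ _).trans ((add_le_add h1 h2).trans ?_)
  rw [norm_neg]
  have : ((Nat.succ 8 : ℕ) : ℝ) * (((Nat.factorial 8 : ℕ) : ℝ) * (8 : ℕ))⁻¹ ≤ 1 := by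
    norm_num [Nat.factorial]
  have := mul_le_mul_of_nonneg_left this (show 0 ≤ ‖w‖ ^ 8 by positivity)
  linarith

/-- From `4 sinh² (w/2) / w² = 1 + w²/12 + w⁴/360 + …`. This order is needed for the constant term
of `1 / sinh⁴ (w/2)`. -/
lemma tendsto_sinhRem : Tendsto sinhRem (𝓝[≠] 0) (𝓝 (1 / 360)) := by
  rw [tendsto_iff_norm_sub_tendsto_zero]
  have hlim : Tendsto (fun w : ℂ => 2 * ‖w‖ ^ 2) (𝓝[≠] 0) (𝓝 0) := by
    have : Tendsto (fun w : ℂ => 2 * ‖w‖ ^ 2) (𝓝 0) (𝓝 (2 * ‖(0 : ℂ)‖ ^ 2)) :=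
      Continuous.tendsto (by fun_prop) 0
    simp only [norm_zero, ne_eq, OfNat.ofNat_ne_zero, not_false_eq_true, zero_pow, mul_zero] at this
    exact this.mono_left nhdsWithin_le_nhds
  refine squeeze_zero' (Eventually.of_forall fun _ => norm_nonneg _) ?_ hlim
  have hb : ∀ᶠ w : ℂ in 𝓝[≠] 0, w ∈ closedBall (0 : ℂ) 1 :=
    nhdsWithin_le_nhds (closedBall_mem_nhds _ one_pos)
  filter_upwards [hb, self_mem_nhdsWithin] with w hw h0
  have h0 : w ≠ 0 := h0
  rw [mem_closedBall, dist_zero_right] at hw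
  have e : sinhRem w - 1 / 360 =
      2 * (Complex.cosh w - (1 + w ^ 2 / 2 + w ^ 4 / 24 + w ^ 6 / 720)) / w ^ 6 := by
    rw [sinhRem, sinhHalfSq]; field_simp; ring
  have hn : 0 < ‖w‖ := norm_pos_iff.2 h0
  rw [e, norm_div, norm_mul, norm_pow, Complex.norm_ofNat, div_le_iff₀ (by positivity)]
  have := norm_cosh_sub_taylor_le hw
  calc _ ≤ 2 * ‖w‖ ^ 8 := by gcongr
    _ = _ := by ring

lemma tendsto_sinhFactor :
    Tendsto (fun w => 1 + w ^ 2 / 12 + w ^ 4 * sinhRem w) (𝓝[≠] 0) (𝓝 1) := by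
  have hw : Tendsto (fun w : ℂ => w) (𝓝[≠] 0) (𝓝 0) := tendsto_id.mono_left nhdsWithin_le_nhds
  have := (((hw.pow 2).div_const 12).const_add 1).add ((hw.pow 4).mul tendsto_sinhRem)
  simpa using this

lemma tendsto_inv_sinhHalfSq_sub :
    Tendsto (fun w => (sinhHalfSq w)⁻¹ - 4 / w ^ 2) (𝓝[≠] 0) (𝓝 (-1 / 3)) := by
  have hw : Tendsto (fun w : ℂ => w) (𝓝[≠] 0) (𝓝 0) := tendsto_id.mono_left nhdsWithin_le_nhds
  have h := ((((hw.pow 2).mul tendsto_sinhRem).const_add (1 / 12)).const_mul (-4)).div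
    tendsto_sinhFactor one_ne_zero
  norm_num at h
  rw [neg_div]
  refine h.congr' ?_
  filter_upwards [tendsto_sinhFactor.eventually_ne one_ne_zero, self_mem_nhdsWithin] with w hv h0
  have h0 : w ≠ 0 := h0
  rw [sinhHalfSq_eq h0]
  simp only [Pi.div_apply]
  generalize sinhRem w = u at *
  generalize hv' : 1 + w ^ 2 / 12 + w ^ 4 * u = v at *
  -- Eliminating the remainder leaves an identity in `v` and `w`, both known to be nonzero.
  obtain rfl : u = (v - 1 - w ^ 2 / 12) / w ^ 4 := by rw [← hv']; field_simp; ring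
  field_simp
  ring

/-- Squaring the Laurent series: `(16/w⁴) (1 - w²/6 + (3/144 - 2/360) w⁴ + …)`, with constant term
`16 · 11/720 = 11/45`. -/
lemma tendsto_inv_sinhHalfSq_sq_sub :
    Tendsto (fun w => (sinhHalfSq w)⁻¹ ^ 2 - 16 / w ^ 4 + 8 / (3 * w ^ 2)) (𝓝[≠] 0)
      (𝓝 (11 / 45)) := by
  have hw : Tendsto (fun w : ℂ => w) (𝓝[≠] 0) (𝓝 0) := tendsto_id.mono_left nhdsWithin_le_nhds
  have hu := tendsto_sinhRem
  have h := (((((hu.const_mul 2).const_sub (1 / 36 - 1 / 144)).add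
    ((hw.pow 2).mul ((hu.div_const 6).const_add (1 / 864)))).add
    ((hw.pow 4).mul ((hu.div_const 36).sub (hu.pow 2)))).add
    ((hw.pow 6).mul ((hu.pow 2).div_const 6))).const_mul 16
  have h' := h.div (tendsto_sinhFactor.pow 2) (by norm_num)
  norm_num at h'
  refine h'.congr' ?_
  filter_upwards [tendsto_sinhFactor.eventually_ne one_ne_zero, self_mem_nhdsWithin] with w hv h0
  have h0 : w ≠ 0 := h0
  rw [sinhHalfSq_eq h0]
  simp only [Pi.div_apply]
  generalize sinhRem w = u at *
  generalize hv' : 1 + w ^ 2 / 12 + w ^ 4 * u = v at *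
  obtain rfl : u = (v - 1 - w ^ 2 / 12) / w ^ 4 := by rw [← hv']; field_simp; ring
  field_simp
  ring

lemma norm_div_sq_le {w : ℂ} (h : 1 / 2 ≤ ‖w‖) : ‖w ^ 2‖⁻¹ ≤ 5 / (1 + ‖w‖ ^ 2) := by
  rw [norm_pow, inv_eq_one_div, div_le_div_iff₀ (by positivity) (by positivity)]
  nlinarith

/-- `1 / sinh² (w / 2)` without its principal part at `0`. -/
noncomputable def invSinhReg : ℂ → ℂ := Function.update (fun w => (sinhHalfSq w)⁻¹ - 4 / w ^ 2) 0 (-1 / 3)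

/-- `1 / sinh⁴ (w / 2)` without its principal part at `0`. -/
noncomputable def invSinhSqReg : ℂ → ℂ :=
  Function.update (fun w => (sinhHalfSq w)⁻¹ ^ 2 - 16 / w ^ 4 + 8 / (3 * w ^ 2)) 0 (11 / 45)

lemma wedgeDecay_invSinhReg {C : ℝ} (hC : 0 < C) : WedgeDecay 1 C invSinhReg := by
  obtain ⟨K, hK, h⟩ := exists_inv_bounds hC
  refine wedgeDecay_update hC (fun w hw h0 => ?_) tendsto_inv_sinhHalfSq_sub (K := K + 20)
    fun w hw h2 => ?_
  · have h1 := differentiable_sinhHalfSq w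
    have h3 := sinhHalfSq_ne_zero hw h0
    have h4 : w ^ 2 ≠ 0 := pow_ne_zero _ h0
    fun_prop (disch := assumption)
  · refine (norm_sub_le _ _).trans ?_
    rw [add_div, div_eq_mul_inv 4, norm_mul, norm_inv (w ^ 2), Complex.norm_ofNat]
    have := norm_div_sq_le h2
    have := (h w hw).2.2.2 h2
    calc _ ≤ K / (1 + ‖w‖ ^ 2) + 4 * (5 / (1 + ‖w‖ ^ 2)) := by gcongr
      _ = _ := by ring

lemma wedgeDecay_invSinhSqReg {C : ℝ} (hC : 0 < C) : WedgeDecay 1 C invSinhSqReg := by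
  obtain ⟨K, hK, h⟩ := exists_inv_bounds hC
  refine wedgeDecay_update hC (fun w hw h0 => ?_) tendsto_inv_sinhHalfSq_sq_sub
    (K := K * K + 400 + 5 * 8)
    fun w hw h2 => ?_
  · have h1 := differentiable_sinhHalfSq w
    have h3 := sinhHalfSq_ne_zero hw h0
    have h4 : w ^ 4 ≠ 0 := pow_ne_zero _ h0
    have h5 : 3 * w ^ 2 ≠ 0 := mul_ne_zero three_ne_zero (pow_ne_zero _ h0)
    fun_prop (disch := assumption)
  · have hp : 1 ≤ 1 + ‖w‖ ^ 2 := by linarith [sq_nonneg ‖w‖]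
    have e1 := norm_div_sq_le h2
    have e2 := (h w hw).2.2.2 h2
    have e3 : ‖w ^ 2‖⁻¹ ≤ 5 := e1.trans (div_le_self (by norm_num) hp)
    have e4 : ‖(sinhHalfSq w)⁻¹‖ ≤ K := e2.trans (div_le_self hK.le hp)
    refine (norm_add_le _ _).trans ((add_le_add_left (norm_sub_le _ _) _).trans ?_)
    have f1 : ‖(sinhHalfSq w)⁻¹ ^ 2‖ ≤ K * K / (1 + ‖w‖ ^ 2) := by
      rw [norm_pow, pow_two, mul_div_assoc]
      gcongr
    have f2 : ‖16 / w ^ 4‖ ≤ 400 / (1 + ‖w‖ ^ 2) := by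
      rw [show (16 / w ^ 4 : ℂ) = 16 * (w ^ 2)⁻¹ * (w ^ 2)⁻¹ by field_simp, norm_mul, norm_mul,
        norm_inv, Complex.norm_ofNat]
      calc _ ≤ 16 * 5 * (5 / (1 + ‖w‖ ^ 2)) := by gcongr
        _ = _ := by ring
    have f3 : ‖8 / (3 * w ^ 2)‖ ≤ 5 * 8 / (1 + ‖w‖ ^ 2) := by
      rw [div_eq_mul_inv, mul_inv, norm_mul, norm_mul, norm_inv (w ^ 2), norm_inv,
        Complex.norm_ofNat, Complex.norm_ofNat]
      calc _ ≤ 8 * (1 * (5 / (1 + ‖w‖ ^ 2))) := by gcongr; norm_num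
        _ = _ := by ring
    rw [add_div, add_div]
    gcongr

lemma sinhHalfSq_neg (w : ℂ) : sinhHalfSq (-w) = sinhHalfSq w := by
  simp [sinhHalfSq]

lemma coshHalfSq_neg (w : ℂ) : coshHalfSq (-w) = coshHalfSq w := by
  simp [coshHalfSq]

lemma invSinhReg_neg (w : ℂ) : invSinhReg (-w) = invSinhReg w := by
  by_cases h : w = 0
  · simp [h]
  · rw [invSinhReg, Function.update_of_ne h, Function.update_of_ne (neg_ne_zero.2 h),
      sinhHalfSq_neg, neg_sq]

lemma invSinhSqReg_neg (w : ℂ) : invSinhSqReg (-w) = invSinhSqReg w := by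
  by_cases h : w = 0
  · simp [h]
  · rw [invSinhSqReg, Function.update_of_ne h, Function.update_of_ne (neg_ne_zero.2 h),
      sinhHalfSq_neg, neg_sq, Even.neg_pow (by decide)]


/-! ### Calculus of asymptotic power series. -/

/-- `f` has an asymptotic power series expansion along `l`. -/
def PowAsymp (l : Filter ℂ) (f : ℂ → ℂ) : Prop :=
  ∃ h : ℕ → ℂ, ∀ N : ℕ,
    (fun z => f z - ∑ k ∈ Finset.range N, h k * z ^ k) =O[l] fun z => z ^ N

namespace PowAsymp

variable {l : Filter ℂ} {f g : ℂ → ℂ}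

lemma congr' (hf : PowAsymp l f) (h : f =ᶠ[l] g) : PowAsymp l g := by
  obtain ⟨a, ha⟩ := hf
  refine ⟨a, fun N => (ha N).congr' ?_ EventuallyEq.rfl⟩
  filter_upwards [h] with z hz
  rw [hz]

lemma add (hf : PowAsymp l f) (hg : PowAsymp l g) : PowAsymp l fun z => f z + g z := by
  obtain ⟨a, ha⟩ := hf
  obtain ⟨b, hb⟩ := hg
  refine ⟨fun k => a k + b k, fun N => ((ha N).add (hb N)).congr_left fun z => ?_⟩
  simp only [add_mul, Finset.sum_add_distrib]
  ring

lemma const_mul (c : ℂ) (hf : PowAsymp l f) : PowAsymp l fun z => c * f z := by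
  obtain ⟨a, ha⟩ := hf
  refine ⟨fun k => c * a k, fun N => ((ha N).const_mul_left c).congr_left fun z => ?_⟩
  simp only [mul_sub, Finset.mul_sum, mul_assoc]

lemma isBigO_one_of_le (hl : l ≤ 𝓝 0) {u : ℂ → ℂ} (hu : ContinuousAt u 0) :
    u =O[l] fun _ => (1 : ℂ) :=
  (hu.tendsto.isBigO_one ℂ).mono hl

lemma id_mul (hl : l ≤ 𝓝 0) (hf : PowAsymp l f) : PowAsymp l fun z => z * f z := by
  obtain ⟨a, ha⟩ := hf
  refine ⟨fun k => if k = 0 then 0 else a (k - 1), fun N => ?_⟩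
  cases N with
  | zero =>
    have h0 := ha 0
    simp only [Finset.range_zero, Finset.sum_empty, sub_zero, pow_zero] at h0 ⊢
    simpa using (isBigO_one_of_le hl continuousAt_id).mul h0
  | succ N =>
    have h1 := (isBigO_refl (fun z : ℂ => z) l).mul (ha N)
    refine (h1.congr_left fun z => ?_).congr_right fun z => by ring
    rw [Finset.sum_range_succ']
    have e : ∑ k ∈ Finset.range N, z * (a k * z ^ k) = ∑ k ∈ Finset.range N, a k * z ^ (k + 1) :=
      Finset.sum_congr rfl fun k _ => by ring
    simp [mul_sub, Finset.mul_sum, e]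

lemma linear_mul (hl : l ≤ 𝓝 0) (c d : ℂ) (hf : PowAsymp l f) :
    PowAsymp l fun z => (c + d * z) * f z :=
  ((hf.const_mul c).add ((hf.id_mul hl).const_mul d)).congr'
    (Eventually.of_forall fun z => by ring)

lemma div_linear (hl : l ≤ 𝓝 0) (c : ℂ) (hf : PowAsymp l f) :
    PowAsymp l fun z => f z / (1 + c * z) := by
  obtain ⟨a, ha⟩ := hf
  have hcont : ContinuousAt (fun z : ℂ => 1 + c * z) 0 := by fun_prop
  have hne : ∀ᶠ z in l, 1 + c * z ≠ 0 :=
    hl (hcont.eventually_ne (by simp))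
  have hinv : (fun z : ℂ => (1 + c * z)⁻¹) =O[l] fun _ => (1 : ℂ) :=
    isBigO_one_of_le hl (hcont.inv₀ (by simp))
  -- Coefficients of the formal quotient by `1 + c z`. Multiplying a partial sum back telescopes to
  -- the partial sum of `a` and one boundary term.
  let b : ℕ → ℂ := fun k => Nat.rec (a 0) (fun k x => a (k + 1) - c * x) k
  have hb : ∀ z : ℂ, ∀ N : ℕ, (1 + c * z) * ∑ k ∈ Finset.range (N + 1), b k * z ^ k =
      ∑ k ∈ Finset.range (N + 1), a k * z ^ k + c * b N * z ^ (N + 1) := by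
    intro z N
    induction N with
    | zero => simp [b]; ring
    | succ N ih =>
      rw [Finset.sum_range_succ, mul_add, ih, Finset.sum_range_succ (fun k => a k * z ^ k) (N + 1)]
      have : b (N + 1) = a (N + 1) - c * b N := rfl
      rw [this]
      ring
  refine ⟨b, fun N => ?_⟩
  cases N with
  | zero =>
    have h0 := ha 0
    simp only [Finset.range_zero, Finset.sum_empty, sub_zero, pow_zero] at h0 ⊢
    simpa [div_eq_mul_inv] using h0.mul hinv
  | succ N =>
    have h1 := ((ha (N + 1)).sub ((isBigO_refl (fun z : ℂ => z ^ (N + 1)) l).const_mul_left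
      (c * b N))).mul hinv
    simp only [mul_one] at h1
    refine h1.congr' ?_ EventuallyEq.rfl
    filter_upwards [hne] with z hz
    have := hb z N
    field_simp
    linear_combination this

end PowAsymp

/-! ### Series over the nodes `(n + 1) κ β₀`. -/

/-- The argument `(n + 1) κ β₀` of the `n`-th summand. -/
noncomputable def node (β₀ : ℝ) (κ : ℂ) (n : ℕ) : ℂ := (n + 1 : ℕ) * κ * β₀

lemma kappaOf_sq (z : ℂ) : kappaOf z ^ 2 = z := by
  simp [kappaOf]

lemma norm_kappaOf_sq (z : ℂ) : ‖kappaOf z‖ ^ 2 = ‖z‖ := by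
  rw [← norm_pow, kappaOf_sq]

section nodes

variable {β₀ C : ℝ} {κ : ℂ}

lemma mul_mem_openSector (hβ : 0 < β₀) (hκ : κ ∈ openSector C) : κ * β₀ ∈ openSector C := by
  have h : |κ.im| < C * κ.re := hκ
  show |(κ * β₀).im| < C * (κ * β₀).re
  simp only [Complex.mul_im, Complex.mul_re, Complex.ofReal_re, Complex.ofReal_im, mul_zero,
    zero_add, sub_zero, abs_mul, abs_of_pos hβ]
  nlinarith

lemma node_mem_wedge (hβ : 0 < β₀) (hC : 0 < C) (hκ : κ ∈ openSector C) (n : ℕ) :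
    node β₀ κ n ∈ wedge 1 C := by
  have := mul_real_mem_wedge one_pos hC (mul_mem_openSector hβ hκ) ((n + 1 : ℕ) : ℝ)
  rw [mul_comm] at this
  rw [node, mul_assoc]
  exact_mod_cast this

lemma node_ne_zero (hβ : 0 < β₀) (hκ : κ ∈ openSector C) (n : ℕ) : node β₀ κ n ≠ 0 :=
  mul_ne_zero (mul_ne_zero (Nat.cast_ne_zero.2 n.succ_ne_zero) (ne_zero_of_mem_openSector hκ))
    (Complex.ofReal_ne_zero.2 hβ.ne')

lemma hasSum_inv_node_sq :
    HasSum (fun n => 1 / node β₀ κ n ^ 2) ((Real.pi ^ 2 / 6 : ℝ) / (κ * β₀) ^ 2 : ℂ) := by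
  -- The zeta series is indexed from `0`, where its term is `1 / 0 = 0`; dropping that term matches
  -- the nodes.
  have h := (hasSum_nat_add_iff' 1).2 hasSum_zeta_two
  simp only [Finset.range_one, Finset.sum_singleton, Nat.cast_zero, ne_eq, OfNat.ofNat_ne_zero,
    not_false_eq_true, zero_pow, div_zero, sub_zero] at h
  refine ((Complex.hasSum_ofReal.2 h).div_const _).congr_fun ?_
  intro n
  simp only [node]
  push_cast
  rw [div_div, ← mul_pow, ← mul_assoc]

lemma hasSum_inv_node_four :
    HasSum (fun n => 1 / node β₀ κ n ^ 4) ((Real.pi ^ 4 / 90 : ℝ) / (κ * β₀) ^ 4 : ℂ) := by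
  have h := (hasSum_nat_add_iff' 1).2 hasSum_zeta_four
  simp only [Finset.range_one, Finset.sum_singleton, Nat.cast_zero, ne_eq, OfNat.ofNat_ne_zero,
    not_false_eq_true, zero_pow, div_zero, sub_zero] at h
  refine ((Complex.hasSum_ofReal.2 h).div_const _).congr_fun ?_
  intro n
  simp only [node]
  push_cast
  rw [div_div, ← mul_pow, ← mul_assoc]

lemma WedgeDecay.summable_node {g : ℂ → ℂ} (hβ : 0 < β₀) (hC : 0 < C) (h : WedgeDecay 1 C g)
    (hκ : κ ∈ openSector C) : Summable fun n => g (node β₀ κ n) := by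
  simpa only [node, mul_assoc] using h.summable_ray one_pos hC (mul_mem_openSector hβ hκ)

lemma WedgeDecay.exists_tsum_norm_le {g : ℂ → ℂ} (hβ : 0 < β₀) (hC : 0 < C)
    (h : WedgeDecay 1 C g) :
    ∃ B : ℝ, ∀ κ ∈ openSector C, Summable (fun n => ‖g (node β₀ κ n)‖) ∧
      ∑' n, ‖g (node β₀ κ n)‖ ≤ B / ‖κ‖ ^ 2 := by
  obtain ⟨K, hK0, hK⟩ := h.exists_bound
  have hs : Summable fun n : ℕ => (((n + 1 : ℕ) : ℝ) ^ 2)⁻¹ :=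
    (summable_nat_add_iff 1).2 (Real.summable_nat_pow_inv.2 one_lt_two)
  refine ⟨K / β₀ ^ 2 * ∑' n : ℕ, (((n + 1 : ℕ) : ℝ) ^ 2)⁻¹, fun κ hκ => ?_⟩
  have h0 : 0 < ‖κ‖ := norm_pos_iff.2 (ne_zero_of_mem_openSector hκ)
  have hle : ∀ n, ‖g (node β₀ κ n)‖ ≤ K / β₀ ^ 2 / ‖κ‖ ^ 2 * (((n + 1 : ℕ) : ℝ) ^ 2)⁻¹ := by
    intro n
    refine (hK _ (node_mem_wedge hβ hC hκ n)).trans ?_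
    have : ‖node β₀ κ n‖ = ((n + 1 : ℕ) : ℝ) * ‖κ‖ * β₀ := by
      rw [node, norm_mul, norm_mul, Complex.norm_natCast, Complex.norm_real, Real.norm_eq_abs,
        abs_of_pos hβ]
    rw [← div_eq_mul_inv, div_div, div_div, this]
    gcongr
    calc _ = (((n + 1 : ℕ) : ℝ) * ‖κ‖ * β₀) ^ 2 := by ring
      _ ≤ _ := by linarith
  have hs' := hs.mul_left (K / β₀ ^ 2 / ‖κ‖ ^ 2)
  have hsn := Summable.of_nonneg_of_le (fun _ => norm_nonneg _) hle hs'
  refine ⟨hsn, (hsn.tsum_le_tsum hle hs').trans (le_of_eq ?_)⟩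
  rw [tsum_mul_left]
  ring

lemma hasSum_inv_sinhHalfSq (hβ : 0 < β₀) (hC : 0 < C) (hκ : κ ∈ openSector C) :
    HasSum (fun n => (sinhHalfSq (node β₀ κ n))⁻¹)
      (∑' n, invSinhReg (node β₀ κ n) + 4 * ((Real.pi ^ 2 / 6 : ℝ) / (κ * β₀) ^ 2)) := by
  refine (((wedgeDecay_invSinhReg hC).summable_node hβ hC hκ).hasSum.add
    (hasSum_inv_node_sq.mul_left 4)).congr_fun fun n => ?_
  rw [invSinhReg, Function.update_of_ne (node_ne_zero hβ hκ n)]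
  ring

lemma hasSum_inv_sinhHalfSq_sq (hβ : 0 < β₀) (hC : 0 < C) (hκ : κ ∈ openSector C) :
    HasSum (fun n => (sinhHalfSq (node β₀ κ n))⁻¹ ^ 2)
      (∑' n, invSinhSqReg (node β₀ κ n) + 16 * ((Real.pi ^ 4 / 90 : ℝ) / (κ * β₀) ^ 4)
        + (-8 / 3) * ((Real.pi ^ 2 / 6 : ℝ) / (κ * β₀) ^ 2)) := by
  refine ((((wedgeDecay_invSinhSqReg hC).summable_node hβ hC hκ).hasSum.add
    (hasSum_inv_node_four.mul_left 16)).add (hasSum_inv_node_sq.mul_left (-8 / 3))).congr_fun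
    fun n => ?_
  have := node_ne_zero hβ hκ n
  rw [invSinhSqReg, Function.update_of_ne this]
  field_simp
  ring

/-- Summability of `s⁻¹` forces `‖a s‖ > 2` eventually, and then `‖1 + a s‖` is at least `1` and at
least `‖a s‖ / 2`. A possible zero of `1 + a s` affects only finitely many terms. -/
lemma summable_inv_one_add_mul (hβ : 0 < β₀) (hC : 0 < C) (hκ : κ ∈ openSector C) {a : ℂ}
    (ha : a ≠ 0) (j : ℕ) :
    Summable fun n => (1 + a * sinhHalfSq (node β₀ κ n))⁻¹ ^ (j + 1) := by
  have hs := (hasSum_inv_sinhHalfSq hβ hC hκ).summable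
  have hlim := hs.tendsto_atTop_zero
  have ha' : 0 < ‖a‖ := norm_pos_iff.2 ha
  rw [tendsto_zero_iff_norm_tendsto_zero] at hlim
  refine Summable.of_norm_bounded_eventually_nat (hs.norm.mul_left (2 / ‖a‖)) ?_
  filter_upwards [hlim.eventually_lt_const (show 0 < ‖a‖ / 2 by positivity)] with n hn
  have hne := sinhHalfSq_ne_zero (node_mem_wedge hβ hC hκ n) (node_ne_zero hβ hκ n)
  generalize sinhHalfSq (node β₀ κ n) = s at *
  have hs0 : 0 < ‖s‖ := norm_pos_iff.2 hne
  rw [norm_inv, inv_lt_comm₀ hs0 (by positivity), inv_div, div_lt_iff₀ ha'] at hn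
  have h1 : ‖a‖ * ‖s‖ - 1 ≤ ‖1 + a * s‖ := by
    have := norm_sub_le (1 + a * s) 1
    rw [add_sub_cancel_left, norm_mul, norm_one] at this
    linarith
  have h2 : ‖(1 + a * s)⁻¹‖ ≤ 2 / ‖a‖ * ‖s⁻¹‖ := by
    rw [norm_inv, norm_inv, ← div_eq_mul_inv, div_div, inv_eq_one_div,
      div_le_div_iff₀ (by linarith) (by positivity)]
    linarith
  have h3 : ‖(1 + a * s)⁻¹‖ ≤ 1 := by
    rw [norm_inv]; exact inv_le_one_of_one_le₀ (by linarith)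
  rw [norm_pow, pow_succ]
  calc _ ≤ 1 ^ j * (2 / ‖a‖ * ‖s⁻¹‖) := by gcongr
    _ = _ := by ring

end nodes

/-! ### Asymptotics of the elementary series as `κ² → 0`. -/

section asymptotics

variable {β₀ C : ℝ} {l : Filter ℂ}

lemma WedgeDecay.exists_isBigO {g : ℂ → ℂ} (hβ : 0 < β₀) (hC : 0 < C) (hl : l ≤ 𝓝 0)
    (hS : ∀ᶠ z in l, kappaOf z ∈ openSector C)
    (h : WedgeDecay 1 C g) (heven : ∀ w, g (-w) = g w) :
    ∃ I : ℂ, ∀ N : ℕ, (fun z => kappaOf z * (∑' n, g (node β₀ (kappaOf z) n) + g 0 / 2) - I)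
      =O[l] fun z => z ^ N := by
  obtain ⟨I, hI⟩ := h.exists_norm_tsum_sub_le one_pos hC heven
  refine ⟨I / β₀, fun N => ?_⟩
  -- An error of order `2 N + 1` in `κ`, times the factor `κ`, is of order `z ^ (N + 1)`.
  obtain ⟨K, hK⟩ := hI (2 * N)
  have h1 : (fun z => kappaOf z * (∑' n, g (node β₀ (kappaOf z) n) + g 0 / 2) - I / β₀)
      =O[l] fun z : ℂ => z ^ (N + 1) := by
    refine IsBigO.of_bound (K * β₀ ^ (2 * N + 1)) ?_
    filter_upwards [hS] with z hz
    have hk0 := ne_zero_of_mem_openSector hz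
    have hb0 : (β₀ : ℂ) ≠ 0 := Complex.ofReal_ne_zero.2 hβ.ne'
    have e : kappaOf z * (∑' n, g (node β₀ (kappaOf z) n) + g 0 / 2) - I / β₀ =
        kappaOf z * (∑' n : ℕ, g ((n + 1 : ℕ) * (kappaOf z * β₀)) -
          (I / (kappaOf z * β₀) - g 0 / 2)) := by
      simp only [node, mul_assoc]
      field_simp
      ring_nf
    rw [e, norm_mul, norm_pow, ← norm_kappaOf_sq z]
    refine (mul_le_mul_of_nonneg_left (hK _ (mul_mem_openSector hβ hz)) (norm_nonneg _)).trans
      (le_of_eq ?_)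
    rw [norm_mul, Complex.norm_real, Real.norm_eq_abs, abs_of_pos hβ]
    ring
  refine h1.trans ?_
  have := (isBigO_refl (fun z : ℂ => z ^ N) l).mul
    (PowAsymp.isBigO_one_of_le hl (u := fun z : ℂ => z) continuousAt_id)
  simpa [pow_succ] using this

lemma powAsymp_of_isBigO_sub_const {f : ℂ → ℂ} {I : ℂ}
    (h : ∀ N : ℕ, (fun z => f z - I) =O[l] fun z => z ^ N)
    (hl : l ≤ 𝓝 0) : PowAsymp l f := by
  refine ⟨fun k => if k = 0 then I else 0, fun N => ?_⟩
  cases N with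
  | zero =>
    have h0 := (h 0).add (PowAsymp.isBigO_one_of_le hl (u := fun _ => I) continuousAt_const)
    simpa using h0
  | succ N =>
    refine (h (N + 1)).congr_left fun z => ?_
    rw [Finset.sum_range_succ']
    simp

/-- The subtracted terms are `4 ζ(2) / (κ β₀)²` from the principal part and `-g 0 / 2 = 1/6` from
the value `-1/3` at `0`. -/
lemma powAsymp_tsum_inv_sinhHalfSq (hβ : 0 < β₀) (hC : 0 < C) (hl : l ≤ 𝓝 0)
    (hS : ∀ᶠ z in l, kappaOf z ∈ openSector C) :
    PowAsymp l fun z => kappaOf z * (∑' n, (sinhHalfSq (node β₀ (kappaOf z) n))⁻¹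
      - 2 * (Real.pi : ℂ) ^ 2 / (3 * z * β₀ ^ 2) - 1 / 6) := by
  obtain ⟨I, hI⟩ := (wedgeDecay_invSinhReg hC).exists_isBigO hβ hC hl hS invSinhReg_neg
  refine (powAsymp_of_isBigO_sub_const hI hl).congr' ?_
  filter_upwards [hS] with z hz
  rw [(hasSum_inv_sinhHalfSq hβ hC hz).tsum_eq, mul_pow, kappaOf_sq]
  simp only [invSinhReg, Function.update_self]
  push_cast
  ring

/-- The principal part contributes `16 ζ(4) / (κ β₀)⁴ - (8/3) ζ(2) / (κ β₀)²`, and the value `11/45`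
at `0` contributes `-11/90`. -/
lemma powAsymp_tsum_inv_sinhHalfSq_sq (hβ : 0 < β₀) (hC : 0 < C) (hl : l ≤ 𝓝 0)
    (hS : ∀ᶠ z in l, kappaOf z ∈ openSector C) :
    PowAsymp l fun z => kappaOf z * (∑' n, (sinhHalfSq (node β₀ (kappaOf z) n))⁻¹ ^ 2
      - 8 * (Real.pi : ℂ) ^ 4 / (45 * z ^ 2 * β₀ ^ 4) + 4 * (Real.pi : ℂ) ^ 2 / (9 * z * β₀ ^ 2)
      + 11 / 90) := by
  obtain ⟨I, hI⟩ := (wedgeDecay_invSinhSqReg hC).exists_isBigO hβ hC hl hS invSinhSqReg_neg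
  refine (powAsymp_of_isBigO_sub_const hI hl).congr' ?_
  filter_upwards [hS] with z hz
  rw [(hasSum_inv_sinhHalfSq_sq hβ hC hz).tsum_eq, mul_pow, mul_pow, kappaOf_sq,
    show kappaOf z ^ 4 = (kappaOf z ^ 2) ^ 2 by ring, kappaOf_sq]
  simp only [invSinhSqReg, Function.update_self]
  push_cast
  ring

end asymptotics

/-- Isolates the small parameter `q`: it multiplies `tanh² (w/2)`, which is bounded on the wedge. -/
lemma one_add_mul_sinhHalfSq {q w : ℂ} (hc : coshHalfSq w ≠ 0) :
    1 + (1 + q) * sinhHalfSq w = coshHalfSq w * (1 + q * (sinhHalfSq w / coshHalfSq w)) := by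
  have e : coshHalfSq w = 1 + sinhHalfSq w := by rw [coshHalfSq, sinhHalfSq]; ring
  field_simp
  rw [e]
  ring

/-- Taylor expansion of `(1 + x)⁻¹ ^ (j + 1)` at `0`. -/
lemma exists_taylor_inv_pow (j : ℕ) :
    ∃ e : ℕ → ℂ, e 0 = 1 ∧ ∀ N : ℕ, ∃ δ > 0, ∃ K : ℝ, ∀ x : ℂ, ‖x‖ < δ →
      ‖(1 + x)⁻¹ ^ (j + 1) - ∑ k ∈ Finset.range N, e k * x ^ k‖ ≤ K * ‖x‖ ^ N := by
  have ha : AnalyticAt ℂ (fun x : ℂ => (1 + x)⁻¹ ^ (j + 1)) 0 := by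
    refine ((analyticAt_const.add analyticAt_id).inv ?_).pow _
    simp
  have hp := ha.hasFPowerSeriesAt
  refine ⟨fun n => iteratedDeriv n (fun x : ℂ => (1 + x)⁻¹ ^ (j + 1)) 0 / n.factorial, by simp,
    fun N => ?_⟩
  · have := hp.isBigO_sub_partialSum_pow N
    obtain ⟨K, hK⟩ := this.bound
    obtain ⟨δ, hδ, hb⟩ := Metric.eventually_nhds_iff.1 hK
    refine ⟨δ, hδ, K, fun x hx => ?_⟩
    have := hb (y := x) (by simpa using hx)
    simpa [FormalMultilinearSeries.partialSum, FormalMultilinearSeries.ofScalars_apply_eq,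
      mul_comm] using this

section asymptotics

variable {β₀ C : ℝ} {l : Filter ℂ}

/-- The summand varies with `z`, so the Euler-Maclaurin asymptotics apply only to the coefficients
of its expansion in `r² z`. Each contributes its integral constant `I k`; only the one with `k = 0`
is nonzero at `w = 0`, with value `1`, whence the `1 / 2`. -/
lemma powAsymp_tsum_inv_one_add_mul (hβ : 0 < β₀) (hC : 0 < C) (hl : l ≤ 𝓝 0)
    (hS : ∀ᶠ z in l, kappaOf z ∈ openSector C) (r : ℝ) (j : ℕ) :
    PowAsymp l fun z => kappaOf z *
      (∑' n, (1 + (1 + r ^ 2 * z) * sinhHalfSq (node β₀ (kappaOf z) n))⁻¹ ^ (j + 1) + 1 / 2) := by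
  obtain ⟨e, he0, he⟩ := exists_taylor_inv_pow j
  set g : ℕ → ℂ → ℂ := fun k w =>
    (coshHalfSq w)⁻¹ ^ (j + 1) * (sinhHalfSq w / coshHalfSq w) ^ k with hg
  have hgd : ∀ k, WedgeDecay 1 C (g k) := fun k => wedgeDecay_inv_coshHalfSq_pow hC j k
  have hgI : ∀ k, ∃ I : ℂ, ∀ N : ℕ, (fun z => kappaOf z *
      (∑' n, g k (node β₀ (kappaOf z) n) + g k 0 / 2) - I) =O[l] fun z => z ^ N :=
    fun k => (hgd k).exists_isBigO hβ hC hl hS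
      fun w => by simp only [hg, sinhHalfSq_neg, coshHalfSq_neg]
  choose I hI using hgI
  obtain ⟨M, hM0, hM⟩ := exists_inv_bounds hC
  have hg0 : ∀ k, g k 0 = if k = 0 then 1 else 0 := by
    intro k
    have h1 : sinhHalfSq 0 = 0 := by simp [sinhHalfSq]
    have h2 : coshHalfSq 0 = 1 := by simp [coshHalfSq]
    simp [hg, h1, h2, zero_pow_eq]
  have hq : ContinuousAt (fun z : ℂ => (r : ℂ) ^ 2 * z) 0 := by fun_prop
  have ha : ∀ᶠ z in l, (1 + r ^ 2 * z : ℂ) ≠ 0 :=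
    hl ((hq.const_add 1).eventually_ne (by simp))
  refine ⟨fun k => e k * (r ^ 2) ^ k * I k, fun N => ?_⟩
  -- `N + 1` terms are kept because summing the remainder over the nodes costs a factor `1 / ‖κ‖² =
  -- 1 / ‖z‖`.
  set Rem : ℂ → ℂ := fun z => kappaOf z *
    ∑' n, ((1 + (1 + r ^ 2 * z) * sinhHalfSq (node β₀ (kappaOf z) n))⁻¹ ^ (j + 1) -
      ∑ k ∈ Finset.range (N + 1), e k * (r ^ 2 * z) ^ k * g k (node β₀ (kappaOf z) n)) with hRem
  have hRemO : Rem =O[l] fun z => z ^ N := by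
    obtain ⟨δ, hδ, K, hK⟩ := he (N + 1)
    obtain ⟨B, hB⟩ := (hgd (N + 1)).exists_tsum_norm_le hβ hC
    -- Since `tanh²` is bounded by `M`, this puts `r² z tanh² (w/2)` into the disc of the Taylor
    -- estimate for all nodes at once.
    have hsmall : ∀ᶠ z in l, ‖(r : ℂ) ^ 2 * z‖ < δ / M :=
      hl (hq.norm.eventually_lt_const (by simp only [mul_zero, norm_zero]; positivity))
    have hsmall' : ∀ᶠ z in l, ‖z‖ < 1 :=
      hl (continuousAt_id.norm.eventually_lt_const (by simp))
    refine IsBigO.of_bound (|K| * ‖(r : ℂ) ^ 2‖ ^ (N + 1) * |B|) ?_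
    filter_upwards [hS, hsmall, hsmall'] with z hz hz2 hz3
    obtain ⟨hBs, hBz⟩ := hB _ hz
    have hterm : ∀ n, ‖(1 + (1 + r ^ 2 * z) * sinhHalfSq (node β₀ (kappaOf z) n))⁻¹ ^ (j + 1) -
        ∑ k ∈ Finset.range (N + 1), e k * (r ^ 2 * z) ^ k * g k (node β₀ (kappaOf z) n)‖ ≤
        |K| * ‖(r : ℂ) ^ 2 * z‖ ^ (N + 1) * ‖g (N + 1) (node β₀ (kappaOf z) n)‖ := by
      intro n
      obtain ⟨hc, -, hτ, -⟩ := hM _ (node_mem_wedge hβ hC hz n)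
      set w := node β₀ (kappaOf z) n
      set τ := sinhHalfSq w / coshHalfSq w with hτd
      have hlt : ‖(r : ℂ) ^ 2 * z * τ‖ < δ := by
        rw [norm_mul]
        calc _ ≤ ‖(r : ℂ) ^ 2 * z‖ * M := by gcongr
          _ < δ := (lt_div_iff₀ hM0).1 hz2
      have h1 : (1 + (1 + r ^ 2 * z) * sinhHalfSq w)⁻¹ ^ (j + 1) -
          ∑ k ∈ Finset.range (N + 1), e k * (r ^ 2 * z) ^ k * g k w =
          (coshHalfSq w)⁻¹ ^ (j + 1) * ((1 + r ^ 2 * z * τ)⁻¹ ^ (j + 1) -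
            ∑ k ∈ Finset.range (N + 1), e k * (r ^ 2 * z * τ) ^ k) := by
        rw [one_add_mul_sinhHalfSq hc, mul_inv, mul_pow, mul_sub, Finset.mul_sum]
        congr 1
        refine Finset.sum_congr rfl fun k _ => ?_
        simp only [hg, ← hτd]
        ring
      rw [h1, norm_mul]
      calc _ ≤ ‖(coshHalfSq w)⁻¹ ^ (j + 1)‖ * (|K| * ‖(r : ℂ) ^ 2 * z * τ‖ ^ (N + 1)) := by
            gcongr
            exact (hK _ hlt).trans (by gcongr; exact le_abs_self K)
        _ = _ := by
            simp only [hg, ← hτd, norm_mul, norm_pow]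
            ring
    have hk0 : 0 < ‖kappaOf z‖ := norm_pos_iff.2 (ne_zero_of_mem_openSector hz)
    have hk1 : ‖kappaOf z‖ ≤ 1 := by
      rw [← norm_kappaOf_sq] at hz3
      nlinarith
    have hsum := tsum_of_norm_bounded
      ((hBs.mul_left (|K| * ‖(r : ℂ) ^ 2 * z‖ ^ (N + 1))).hasSum) hterm
    rw [tsum_mul_left] at hsum
    rw [hRem, norm_mul]
    calc _ ≤ 1 * (|K| * ‖(r : ℂ) ^ 2 * z‖ ^ (N + 1) * (|B| / ‖kappaOf z‖ ^ 2)) := by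
          gcongr
          refine hsum.trans ?_
          gcongr
          exact hBz.trans (by gcongr; exact le_abs_self B)
      _ = _ := by
          rw [norm_kappaOf_sq, norm_mul, norm_pow z]
          have hz0 : ‖z‖ ≠ 0 := by rw [← norm_kappaOf_sq]; positivity
          field_simp
          ring
  have hsplit : ∀ᶠ z in l, kappaOf z *
      (∑' n, (1 + (1 + r ^ 2 * z) * sinhHalfSq (node β₀ (kappaOf z) n))⁻¹ ^ (j + 1) + 1 / 2) =
      Rem z + ∑ k ∈ Finset.range (N + 1), e k * (r ^ 2 * z) ^ k * (kappaOf z *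
        (∑' n, g k (node β₀ (kappaOf z) n) + g k 0 / 2)) := by
    filter_upwards [hS, ha] with z hz haz
    have hs1 := summable_inv_one_add_mul hβ hC hz haz j
    have hs2 : ∀ k ∈ Finset.range (N + 1),
        Summable fun n => e k * (r ^ 2 * z) ^ k * g k (node β₀ (kappaOf z) n) :=
      fun k _ => ((hgd k).summable_node hβ hC hz).mul_left _
    simp only [hRem]
    rw [hs1.tsum_sub (summable_sum hs2), Summable.tsum_finsetSum hs2]
    simp only [tsum_mul_left]
    have h0 : ∑ k ∈ Finset.range (N + 1), e k * (r ^ 2 * z) ^ k * g k 0 = 1 := by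
      rw [Finset.sum_range_succ']
      simp [hg0, he0]
    have h2 : ∑ k ∈ Finset.range (N + 1), e k * (r ^ 2 * z) ^ k * (kappaOf z *
        (∑' n, g k (node β₀ (kappaOf z) n) + g k 0 / 2)) = kappaOf z *
        (∑ k ∈ Finset.range (N + 1), e k * (r ^ 2 * z) ^ k * ∑' n, g k (node β₀ (kappaOf z) n)
        + (∑ k ∈ Finset.range (N + 1), e k * (r ^ 2 * z) ^ k * g k 0) / 2) := by
      rw [Finset.sum_div, ← Finset.sum_add_distrib, Finset.mul_sum]
      exact Finset.sum_congr rfl fun k _ => by ring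
    rw [h2, h0]
    ring
  have hpow : ∀ k, (fun z : ℂ => e k * (r ^ 2 * z) ^ k) =O[l] fun _ => (1 : ℂ) := fun k =>
    PowAsymp.isBigO_one_of_le hl (by fun_prop)
  have hsumO : (fun z => ∑ k ∈ Finset.range N, e k * (r ^ 2 * z) ^ k * (kappaOf z *
        (∑' n, g k (node β₀ (kappaOf z) n) + g k 0 / 2) - I k)) =O[l] fun z => z ^ N := by
    refine IsBigO.fun_sum fun k _ => ?_
    simpa using (hpow k).mul (hI k N)
  -- The extra term `k = N` is already of the order of the allowed error.
  have hlast : (fun z => e N * (r ^ 2 * z) ^ N * (kappaOf z *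
        (∑' n, g N (node β₀ (kappaOf z) n) + g N 0 / 2))) =O[l] fun z => z ^ N := by
    have h1 : (fun z : ℂ => e N * (r ^ 2 * z) ^ N) =O[l] fun z => z ^ N := by
      simp only [mul_pow, ← mul_assoc]
      exact (isBigO_refl _ l).const_mul_left _
    have h2 := (hI N 0).add (PowAsymp.isBigO_one_of_le hl (u := fun _ => I N) continuousAt_const)
    simpa using h1.mul h2
  refine ((hRemO.add hsumO).add hlast).congr' ?_ EventuallyEq.rfl
  filter_upwards [hsplit] with z hz
  rw [hz, Finset.sum_range_succ]
  simp only [mul_sub, Finset.sum_sub_distrib]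
  have : ∑ k ∈ Finset.range N, e k * (r ^ 2 * z) ^ k * I k =
      ∑ k ∈ Finset.range N, e k * (r ^ 2) ^ k * I k * z ^ k :=
    Finset.sum_congr rfl fun k _ => by ring
  rw [this]
  ring

end asymptotics

/-! ### Partial fractions of the summands -/

lemma sinh_half_sq (w : ℂ) : Complex.sinh (w / 2) ^ 2 = sinhHalfSq w := by
  have h1 := Complex.cosh_two_mul (w / 2)
  have h2 := Complex.cosh_sq (w / 2)
  rw [mul_div_cancel₀ w two_ne_zero] at h1
  rw [sinhHalfSq]
  linear_combination -h1 / 2 - h2 / 2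

lemma sinh_half_four (w : ℂ) : Complex.sinh (w / 2) ^ 4 = sinhHalfSq w ^ 2 := by
  rw [← sinh_half_sq]; ring

lemma cosh_eq_sinhHalfSq (w : ℂ) : Complex.cosh w = 1 + 2 * sinhHalfSq w := by
  rw [sinhHalfSq]; ring

lemma cosh_two_mul_eq_sinhHalfSq (w : ℂ) :
    Complex.cosh (2 * w) = 1 + 8 * sinhHalfSq w + 8 * sinhHalfSq w ^ 2 := by
  have h1 := Complex.cosh_two_mul w
  have h2 := Complex.cosh_sq w
  linear_combination h1 - h2 + 2 * (Complex.cosh w + 1 + 2 * sinhHalfSq w) * cosh_eq_sinhHalfSq w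

lemma denom_eq (r : ℝ) (κ w : ℂ) :
    denom r κ w = 2 * (1 + (1 + r ^ 2 * κ ^ 2) * sinhHalfSq w) := by
  rw [denom, cosh_eq_sinhHalfSq]; ring

lemma rhoTerm_eq {r : ℝ} {κ w : ℂ} (hs : sinhHalfSq w ≠ 0) (hd : denom r κ w ≠ 0) :
    rhoTerm r κ w = 1 / 2 * ((sinhHalfSq w)⁻¹ ^ 2 - (1 + r ^ 2 * κ ^ 2) * (sinhHalfSq w)⁻¹
      + (1 + r ^ 2 * κ ^ 2) ^ 2 * (1 + (1 + r ^ 2 * κ ^ 2) * sinhHalfSq w)⁻¹) := by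
  rw [rhoTerm, sinh_half_four]
  rw [denom_eq] at hd ⊢
  have hd := (mul_ne_zero_iff.1 hd).2
  generalize sinhHalfSq w = s at *
  generalize (1 + r ^ 2 * κ ^ 2 : ℂ) = a at *
  field_simp
  ring

lemma pTerm_eq {r : ℝ} {κ w : ℂ} (hs : sinhHalfSq w ≠ 0) (hd : denom r κ w ≠ 0) :
    pTerm r κ w = (sinhHalfSq w)⁻¹ ^ 2 + (1 - r ^ 2 * κ ^ 2) * (sinhHalfSq w)⁻¹
      - (1 + r ^ 2 * κ ^ 2) * (1 - r ^ 2 * κ ^ 2) * (1 + (1 + r ^ 2 * κ ^ 2) * sinhHalfSq w)⁻¹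
      - 2 * (1 + r ^ 2 * κ ^ 2) * (1 + (1 + r ^ 2 * κ ^ 2) * sinhHalfSq w)⁻¹ ^ 2
      - 4 * (1 + r ^ 2 * κ ^ 2) * (r ^ 2 * κ ^ 2) *
        (1 + (1 + r ^ 2 * κ ^ 2) * sinhHalfSq w)⁻¹ ^ 3 := by
  rw [pTerm, sinh_half_four, numP, cosh_two_mul_eq_sinhHalfSq, cosh_eq_sinhHalfSq]
  rw [denom_eq] at hd ⊢
  have hd := (mul_ne_zero_iff.1 hd).2
  generalize sinhHalfSq w = s at *
  obtain ⟨a, ha⟩ : ∃ a : ℂ, a = 1 + r ^ 2 * κ ^ 2 := ⟨_, rfl⟩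
  have e4 : κ ^ 4 * r ^ 4 = (a - 1) ^ 2 := by rw [ha]; ring
  have e2 : κ ^ 2 * r ^ 2 = a - 1 := by rw [ha]; ring
  have e2' : r ^ 2 * κ ^ 2 = a - 1 := by rw [ha]; ring
  simp only [mul_assoc, e4, e2, e2'] at hd ⊢
  rw [add_sub_cancel] at *
  field_simp
  ring

lemma aTerm_eq {r : ℝ} {κ w : ℂ} (hs : sinhHalfSq w ≠ 0) (hd : denom r κ w ≠ 0) :
    aTerm r κ w = 1 / 4 * ((sinhHalfSq w)⁻¹
      - (1 + r ^ 2 * κ ^ 2) * (1 + (1 + r ^ 2 * κ ^ 2) * sinhHalfSq w)⁻¹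
      - (1 + r ^ 2 * κ ^ 2) * (1 + (1 + r ^ 2 * κ ^ 2) * sinhHalfSq w)⁻¹ ^ 2
      + 2 * (1 + r ^ 2 * κ ^ 2) * (1 + (1 + r ^ 2 * κ ^ 2) * sinhHalfSq w)⁻¹ ^ 3) := by
  rw [aTerm, sinh_half_sq, cosh_eq_sinhHalfSq]
  rw [denom_eq] at hd ⊢
  have hd := (mul_ne_zero_iff.1 hd).2
  generalize sinhHalfSq w = s at *
  obtain ⟨a, ha⟩ : ∃ a : ℂ, a = 1 + r ^ 2 * κ ^ 2 := ⟨_, rfl⟩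
  have e2 : κ ^ 2 * r ^ 2 = a - 1 := by rw [ha]; ring
  have e2' : r ^ 2 * κ ^ 2 = a - 1 := by rw [ha]; ring
  simp only [mul_assoc, e2, e2'] at hd ⊢
  rw [add_sub_cancel] at *
  field_simp
  ring

/-! ### The root `κ` and the domain -/

/-- The square root halves the argument, so `κ` has slope at most `tan (θ / 2)`; the added `1` makes
the inequality strict. -/
lemma kappaOf_mem_openSector {z : ℂ} (hz : z ≠ 0) {θ : ℝ} (hθ : θ < Real.pi)
    (harg : |z.arg| ≤ θ) : kappaOf z ∈ openSector (Real.tan (θ / 2) + 1) := by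
  have hθ0 : 0 ≤ θ := (abs_nonneg _).trans harg
  have hl1 : (Complex.log z * (1 / 2)).im = z.arg / 2 := by
    simp [Complex.mul_im, Complex.log_im]; ring
  show |(kappaOf z).im| < (Real.tan (θ / 2) + 1) * (kappaOf z).re
  rw [kappaOf, Complex.cpow_def_of_ne_zero hz, Complex.exp_re, Complex.exp_im, hl1, abs_mul,
    Real.abs_exp]
  set φ := z.arg / 2 with hφ
  have hφθ : |φ| ≤ θ / 2 := by rw [hφ, abs_div, abs_two]; linarith
  have hcosθ : 0 < Real.cos (θ / 2) :=
    Real.cos_pos_of_mem_Ioo ⟨by linarith [Real.pi_pos], by linarith⟩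
  have hcos : Real.cos (θ / 2) ≤ Real.cos φ := by
    rw [← Real.cos_abs φ]
    exact Real.cos_le_cos_of_nonneg_of_le_pi (abs_nonneg _) (by linarith) hφθ
  have hsin : |Real.sin φ| ≤ Real.sin (θ / 2) := by
    rw [Real.abs_sin_eq_sin_abs_of_abs_le_pi (by linarith)]
    exact Real.sin_le_sin_of_le_of_le_pi_div_two (by linarith [abs_nonneg φ, Real.pi_pos])
      (by linarith) hφθ
  have htan : Real.sin (θ / 2) = Real.tan (θ / 2) * Real.cos (θ / 2) :=
    (Real.tan_mul_cos hcosθ.ne').symm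
  have htan0 : 0 ≤ Real.tan (θ / 2) :=
    Real.tan_nonneg_of_nonneg_of_le_pi_div_two (by linarith) (by linarith)
  rw [mul_left_comm]
  refine mul_lt_mul_of_pos_left ?_ (Real.exp_pos _)
  nlinarith

lemma tan_half_add_one_pos {θ : ℝ} (h0 : 0 ≤ θ) (hθ : θ < Real.pi) :
    0 < Real.tan (θ / 2) + 1 := by
  have := Real.tan_nonneg_of_nonneg_of_le_pi_div_two (x := θ / 2) (by linarith) (by linarith)
  linarith

lemma exists_kappaOf_mem_openSector {z : ℂ} (hz : z ∈ Complex.slitPlane) :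
    ∃ C > 0, kappaOf z ∈ openSector C := by
  obtain ⟨h1, h2⟩ := Complex.mem_slitPlane_iff_arg.1 hz
  have h : |z.arg| < Real.pi :=
    abs_lt.2 ⟨Complex.neg_pi_lt_arg z, lt_of_le_of_ne (Complex.arg_le_pi z) h1⟩
  exact ⟨_, tan_half_add_one_pos (abs_nonneg _) h, kappaOf_mem_openSector h2 h le_rfl⟩

/-- For `r ≠ 0` the only zero, `z = -1 / r²`, lies on the cut. -/
lemma one_add_mul_ne_zero_of_mem_slitPlane {z : ℂ} (hz : z ∈ Complex.slitPlane) (r : ℝ) :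
    (1 + r ^ 2 * z : ℂ) ≠ 0 := by
  intro h
  have him : r ^ 2 * z.im = 0 := by
    have := congrArg Complex.im h
    simpa [← Complex.ofReal_pow] using this
  have hre : 1 + r ^ 2 * z.re = 0 := by
    have := congrArg Complex.re h
    simpa [← Complex.ofReal_pow] using this
  rcases Complex.mem_slitPlane_iff.1 hz with h1 | h1
  · nlinarith [sq_nonneg r]
  · have : r ^ 2 = 0 := (mul_eq_zero.1 him).resolve_right h1
    rw [this] at hre
    linarith

lemma kappaOf_ofReal_sq {κ : ℝ} (hκ : 0 < κ) : kappaOf ((κ : ℂ) ^ 2) = κ := by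
  rw [kappaOf, one_div]
  have := Complex.pow_cpow_nat_inv (x := (κ : ℂ)) two_ne_zero
    (by rw [Complex.arg_ofReal_of_nonneg hκ.le]; simp [Real.pi_pos])
    (by rw [Complex.arg_ofReal_of_nonneg hκ.le]; positivity)
  simpa using this

lemma ofReal_sq_mem_domain {κ : ℝ} (hκ : 0 < κ) (β₀ r : ℝ) :
    (κ : ℂ) ^ 2 ∈ domain β₀ r := by
  refine ⟨?_, fun n => ?_⟩
  · rw [← Complex.ofReal_pow]
    exact Complex.ofReal_mem_slitPlane.2 (by positivity)
  · rw [kappaOf_ofReal_sq hκ, denom_eq, sinhHalfSq]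
    have h1 := Real.one_le_cosh (((n + 1 : ℕ) : ℝ) * κ * β₀)
    have h2 : (0 : ℝ) < 2 * (1 + (1 + r ^ 2 * κ ^ 2) *
        ((Real.cosh (((n + 1 : ℕ) : ℝ) * κ * β₀) - 1) / 2)) := by
      have : 0 ≤ (1 + r ^ 2 * κ ^ 2) *
        ((Real.cosh (((n + 1 : ℕ) : ℝ) * κ * β₀) - 1) / 2) := by
        apply mul_nonneg (by positivity); linarith
      linarith
    exact_mod_cast h2.ne'

section series

variable {β₀ r C : ℝ} {z : ℂ}

lemma hasSum_rhoTerm (hβ : 0 < β₀) (hC : 0 < C) (hz : z ∈ domain β₀ r)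
    (hκ : kappaOf z ∈ openSector C) :
    HasSum (fun n => rhoTerm r (kappaOf z) (node β₀ (kappaOf z) n))
      (1 / 2 * (∑' n, (sinhHalfSq (node β₀ (kappaOf z) n))⁻¹ ^ 2
        - (1 + r ^ 2 * z) * ∑' n, (sinhHalfSq (node β₀ (kappaOf z) n))⁻¹
        + (1 + r ^ 2 * z) ^ 2 *
          ∑' n, (1 + (1 + r ^ 2 * z) * sinhHalfSq (node β₀ (kappaOf z) n))⁻¹ ^ (0 + 1))) := by
  have ha := one_add_mul_ne_zero_of_mem_slitPlane hz.1 r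
  have h1 := (hasSum_inv_sinhHalfSq hβ hC hκ).summable.hasSum
  have h2 := (hasSum_inv_sinhHalfSq_sq hβ hC hκ).summable.hasSum
  have h3 := (summable_inv_one_add_mul hβ hC hκ ha 0).hasSum
  refine (((h2.sub (h1.mul_left _)).add (h3.mul_left _)).mul_left _).congr_fun fun n => ?_
  rw [rhoTerm_eq (sinhHalfSq_ne_zero (node_mem_wedge hβ hC hκ n) (node_ne_zero hβ hκ n))
    (hz.2 n), kappaOf_sq, zero_add, pow_one]

lemma hasSum_pTerm (hβ : 0 < β₀) (hC : 0 < C) (hz : z ∈ domain β₀ r)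
    (hκ : kappaOf z ∈ openSector C) :
    HasSum (fun n => pTerm r (kappaOf z) (node β₀ (kappaOf z) n))
      (∑' n, (sinhHalfSq (node β₀ (kappaOf z) n))⁻¹ ^ 2
        + (1 - r ^ 2 * z) * ∑' n, (sinhHalfSq (node β₀ (kappaOf z) n))⁻¹
        - (1 + r ^ 2 * z) * (1 - r ^ 2 * z) *
          ∑' n, (1 + (1 + r ^ 2 * z) * sinhHalfSq (node β₀ (kappaOf z) n))⁻¹ ^ (0 + 1)
        - 2 * (1 + r ^ 2 * z) *
          ∑' n, (1 + (1 + r ^ 2 * z) * sinhHalfSq (node β₀ (kappaOf z) n))⁻¹ ^ (1 + 1)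
        - 4 * (1 + r ^ 2 * z) * (r ^ 2 * z) *
          ∑' n, (1 + (1 + r ^ 2 * z) * sinhHalfSq (node β₀ (kappaOf z) n))⁻¹ ^ (2 + 1)) := by
  have ha := one_add_mul_ne_zero_of_mem_slitPlane hz.1 r
  have h1 := (hasSum_inv_sinhHalfSq hβ hC hκ).summable.hasSum
  have h2 := (hasSum_inv_sinhHalfSq_sq hβ hC hκ).summable.hasSum
  have h3 := fun j => (summable_inv_one_add_mul hβ hC hκ ha j).hasSum
  refine ((((h2.add (h1.mul_left _)).sub ((h3 0).mul_left _)).sub ((h3 1).mul_left _)).sub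
    ((h3 2).mul_left _)).congr_fun fun n => ?_
  rw [pTerm_eq (sinhHalfSq_ne_zero (node_mem_wedge hβ hC hκ n) (node_ne_zero hβ hκ n))
    (hz.2 n), kappaOf_sq, zero_add, pow_one]

lemma hasSum_aTerm (hβ : 0 < β₀) (hC : 0 < C) (hz : z ∈ domain β₀ r)
    (hκ : kappaOf z ∈ openSector C) :
    HasSum (fun n => aTerm r (kappaOf z) (node β₀ (kappaOf z) n))
      (1 / 4 * (∑' n, (sinhHalfSq (node β₀ (kappaOf z) n))⁻¹
        - (1 + r ^ 2 * z) *
          ∑' n, (1 + (1 + r ^ 2 * z) * sinhHalfSq (node β₀ (kappaOf z) n))⁻¹ ^ (0 + 1)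
        - (1 + r ^ 2 * z) *
          ∑' n, (1 + (1 + r ^ 2 * z) * sinhHalfSq (node β₀ (kappaOf z) n))⁻¹ ^ (1 + 1)
        + 2 * (1 + r ^ 2 * z) *
          ∑' n, (1 + (1 + r ^ 2 * z) * sinhHalfSq (node β₀ (kappaOf z) n))⁻¹ ^ (2 + 1))) := by
  have ha := one_add_mul_ne_zero_of_mem_slitPlane hz.1 r
  have h1 := (hasSum_inv_sinhHalfSq hβ hC hκ).summable.hasSum
  have h3 := fun j => (summable_inv_one_add_mul hβ hC hκ ha j).hasSum
  refine ((((h1.sub ((h3 0).mul_left _)).sub ((h3 1).mul_left _)).add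
    ((h3 2).mul_left _)).mul_left _).congr_fun fun n => ?_
  rw [aTerm_eq (sinhHalfSq_ne_zero (node_mem_wedge hβ hC hκ n) (node_ne_zero hβ hκ n))
    (hz.2 n), kappaOf_sq, zero_add, pow_one]

end series

/-- A pole requires `r² z tanh² (w/2) = -1`. As `tanh²` is bounded by `M` on the wedge, poles cannot
accumulate at `0` within a sector that avoids the cut. -/
lemma ball_inter_sector_subset_domain {β₀ : ℝ} (hβ : 0 < β₀) (r : ℝ) {θ : ℝ} (h0 : 0 < θ)
    (hθ : θ < Real.pi) : ∃ ε > 0, ball 0 ε ∩ sector 0 (-θ, θ) ⊆ domain β₀ r := by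
  have hC := tan_half_add_one_pos h0.le hθ
  obtain ⟨M, hM0, hM⟩ := exists_inv_bounds hC
  refine ⟨1 / (r ^ 2 * M + 1), by positivity, ?_⟩
  rintro z ⟨hz, hz0, hz1, hz2⟩
  rw [mem_ball, dist_zero_right, lt_div_iff₀ (by positivity)] at hz
  rw [sub_zero] at hz1 hz2
  have hκ := kappaOf_mem_openSector hz0 hθ (abs_le.2 ⟨hz1, hz2⟩)
  refine ⟨Complex.mem_slitPlane_iff_arg.2 ⟨fun h => ?_, hz0⟩, fun n => ?_⟩
  · simp only [h] at hz2
    linarith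
  · obtain ⟨hc, -, hτ, -⟩ := hM _ (node_mem_wedge hβ hC hκ n)
    change denom r (kappaOf z) (node β₀ (kappaOf z) n) ≠ 0
    rw [denom_eq, one_add_mul_sinhHalfSq hc, kappaOf_sq]
    refine mul_ne_zero two_ne_zero (mul_ne_zero hc fun h => ?_)
    have h1 : ‖(r : ℂ) ^ 2 * z * (sinhHalfSq (node β₀ (kappaOf z) n) /
        coshHalfSq (node β₀ (kappaOf z) n))‖ = 1 := by
      rw [show (r : ℂ) ^ 2 * z * (sinhHalfSq (node β₀ (kappaOf z) n) /
        coshHalfSq (node β₀ (kappaOf z) n)) = -1 by linear_combination h]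
      simp
    rw [norm_mul, norm_mul, norm_pow, Complex.norm_real, Real.norm_eq_abs, sq_abs] at h1
    have h2 : r ^ 2 * ‖z‖ * ‖sinhHalfSq (node β₀ (kappaOf z) n) /
        coshHalfSq (node β₀ (kappaOf z) n)‖ ≤ r ^ 2 * ‖z‖ * M := by gcongr
    nlinarith [norm_nonneg z]

/-! ### Transseries in powers of `κ` -/

lemma tendsto_kappaOf {l : Filter ℂ} (hl : l ≤ 𝓝 0) : Tendsto kappaOf l (𝓝 0) := by
  rw [tendsto_zero_iff_norm_tendsto_zero]
  have h : Tendsto (fun z : ℂ => Real.sqrt ‖z‖) (𝓝 0) (𝓝 0) := by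
    have : Continuous fun z : ℂ => Real.sqrt ‖z‖ := by fun_prop
    simpa using this.tendsto 0
  refine (h.mono_left hl).congr fun z => ?_
  rw [← norm_kappaOf_sq, Real.sqrt_sq (norm_nonneg _)]

/-- The transmonomial `κ ^ k = w ^ (k / 2)`. -/
noncomputable def halfPow (k : ℕ) : Transmonomial := ⟨(k : ℝ) / 2, 0, 0⟩

lemma eval_halfPow (k : ℕ) (z : ℂ) : (halfPow k).eval z = kappaOf z ^ k := by
  simp only [halfPow, Transmonomial.eval, zpow_zero, Finsupp.sum_zero_index, Complex.exp_zero,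
    mul_one, kappaOf]
  rw [← Complex.cpow_nat_mul]
  congr 1
  push_cast
  ring

lemma halfPow_injective : Function.Injective halfPow := by
  intro i j h
  have := congrArg Transmonomial.power h
  simp only [halfPow] at this
  exact_mod_cast (div_left_inj' two_ne_zero).1 this

lemma intPow_eq_halfPow (n : ℕ) : Transmonomial.intPow n = halfPow (2 * n) := by
  simp [Transmonomial.intPow, halfPow]

/-- The sum of an analytic function and of `κ` times a function with an asymptotic power series has a
transseries in powers of `κ`. -/
lemma exists_hasTransseries {f g H : ℂ → ℂ} {S : Set ℂ} {a : ℕ → ℂ}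
    (hg : HasFPowerSeriesAt g (FormalMultilinearSeries.ofScalars ℂ a) 0)
    (hH : PowAsymp (𝓝[S] 0) H) (hf : ∀ᶠ z in 𝓝[S] 0, f z = g z + kappaOf z * H z) :
    ∃ c, HasTransseries f 0 S c ∧ ∀ n : ℕ, c (Transmonomial.intPow n) = a n := by
  obtain ⟨h, hh⟩ := hH
  set l := 𝓝[S] (0 : ℂ)
  have hl : l ≤ 𝓝 0 := nhdsWithin_le_nhds
  -- Even powers of `κ` carry the Taylor coefficients of `g`, odd powers the asymptotic coefficients
  -- of `H`.
  set b : ℕ → ℂ := fun k => if Even k then a (k / 2) else h (k / 2) with hb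
  have hbe : ∀ n, b (2 * n) = a n := fun n => by simp [hb]
  have hbo : ∀ n, b (2 * n + 1) = h n := fun n => by
    have : (2 * n + 1) / 2 = n := by omega
    simp [hb, this]
  set c : Transmonomial → ℂ := Function.extend halfPow b 0 with hc
  have hcm : ∀ k, c (halfPow k) = b k := fun k => halfPow_injective.extend_apply b 0 k
  have hκO : kappaOf =O[l] fun _ => (1 : ℂ) := (tendsto_kappaOf hl).isBigO_one ℂ
  have hsucc : ∀ N, (fun z => kappaOf z ^ (N + 1)) =O[l] fun z => kappaOf z ^ N := fun N => by
    simpa [pow_succ] using (isBigO_refl (fun z => kappaOf z ^ N) l).mul hκO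
  have hgO : ∀ N : ℕ, (fun z => g z - ∑ k ∈ Finset.range N, a k * z ^ k) =O[l] fun z => z ^ N := by
    intro N
    have h1 := ((hg.isBigO_sub_partialSum_pow N).mono hl).trans
      (isBigO_of_le (g := fun z : ℂ => z ^ N) l fun z => by simp)
    refine h1.congr_left fun z => ?_
    simp [FormalMultilinearSeries.partialSum, mul_comm]
  have hsum : ∀ (M : ℕ) (z : ℂ), ∑ k ∈ Finset.range (2 * M), b k * kappaOf z ^ k =
      ∑ k ∈ Finset.range M, a k * z ^ k + kappaOf z * ∑ k ∈ Finset.range M, h k * z ^ k := by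
    intro M z
    induction M with
    | zero => simp
    | succ M ih =>
      rw [show 2 * (M + 1) = 2 * M + 1 + 1 by ring, Finset.sum_range_succ, Finset.sum_range_succ,
        ih, Finset.sum_range_succ, Finset.sum_range_succ, hbe, hbo, pow_succ, pow_mul, kappaOf_sq]
      ring
  have heven : ∀ M : ℕ, (fun z => f z - ∑ k ∈ Finset.range (2 * M), b k * kappaOf z ^ k)
      =O[l] fun z => kappaOf z ^ (2 * M) := by
    intro M
    have h1 := (hgO M).add ((hκO.mul (hh M)).congr_right fun z => one_mul _)
    refine h1.congr' ?_ (Eventually.of_forall fun z => by simp only [pow_mul, kappaOf_sq])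
    filter_upwards [hf] with z hz
    rw [hz, hsum]
    ring
  refine ⟨c, ⟨halfPow, fun k => ?_, fun n => ⟨2 * n, ?_⟩, fun μ hμ => ?_, fun N => ?_⟩, fun n => ?_⟩
  · simp only [sub_zero, eval_halfPow]
    have h1 : kappaOf =o[l] fun _ => (1 : ℂ) := (isLittleO_one_iff ℂ).2 (tendsto_kappaOf hl)
    simpa [pow_succ] using (isBigO_refl (fun z => kappaOf z ^ k) l).mul_isLittleO h1
  · simp only [sub_zero, eval_halfPow, pow_mul, kappaOf_sq]
    exact isBigO_refl _ _
  · rw [hc, Function.extend_apply' _ _ _ (by simpa using hμ)]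
    rfl
  · simp only [sub_zero, eval_halfPow, hcm]
    obtain ⟨M, rfl | rfl⟩ := Nat.even_or_odd' N
    · exact heven M
    -- An odd truncation is the next even one with its last term added back.
    · have h1 := ((heven (M + 1)).trans (hsucc (2 * M + 1))).add
        ((isBigO_refl (fun z => kappaOf z ^ (2 * M + 1)) l).const_mul_left (b (2 * M + 1)))
      refine h1.congr_left fun z => ?_
      rw [show 2 * (M + 1) = 2 * M + 1 + 1 by ring, Finset.sum_range_succ]
      ring
  · rw [intPow_eq_halfPow, hcm, hbe]

/-- A criterion for the analytic distillate of a function on `domain β₀ r`. -/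
lemma isAnalyticDistillate_of_powAsymp {β₀ : ℝ} (hβ : 0 < β₀) (r : ℝ) {f g H : ℂ → ℂ}
    (hg : AnalyticAt ℂ g 0)
    (hH : ∀ C > 0, ∀ l ≤ 𝓝 (0 : ℂ), (∀ᶠ z in l, kappaOf z ∈ openSector C) → PowAsymp l H)
    (hf : ∀ z ∈ domain β₀ r, f z = g z + kappaOf z * H z) :
    IsAnalyticDistillate f (domain β₀ r) 0 g := by
  have key : ∀ θ : ℝ, 0 < θ → θ < Real.pi → ∃ c,
      HasTransseries f 0 (domain β₀ r ∩ sector 0 (-θ, θ)) c ∧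
      ∀ n : ℕ, c (Transmonomial.intPow n) = iteratedDeriv n g 0 / n.factorial := by
    intro θ h0 hθ
    refine exists_hasTransseries hg.hasFPowerSeriesAt
      (hH _ (tan_half_add_one_pos h0.le hθ) _ nhdsWithin_le_nhds ?_) ?_
    · filter_upwards [self_mem_nhdsWithin] with z hz
      obtain ⟨-, hz0, hz1, hz2⟩ := hz
      rw [sub_zero] at hz1 hz2
      exact kappaOf_mem_openSector hz0 hθ (abs_le.2 ⟨hz1, hz2⟩)
    · filter_upwards [self_mem_nhdsWithin] with z hz using hf z hz.1
  choose! c hc using key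
  -- All sectors `|arg z| ≤ θ` with `θ < π` are used: each avoids the cut, and together they exhaust
  -- the slit plane. Their integer-power coefficients all agree.
  refine ⟨{s | ∃ θ : ℝ, 0 < θ ∧ θ < Real.pi ∧ s = (-θ, θ)}, fun s => c s.2,
    fun n => iteratedDeriv n g 0 / n.factorial, ⟨_, 1, one_pos, by linarith [Real.pi_gt_three], rfl⟩,
    ?_, ?_, ?_, ?_, fun n => Or.inl ?_, hg.hasFPowerSeriesAt⟩
  · rintro _ ⟨θ, h0, hθ, rfl⟩
    exact ⟨by simp only; linarith, by simp only; linarith, by simp only; linarith⟩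
  · rintro _ ⟨θ, h0, hθ, rfl⟩
    exact ball_inter_sector_subset_domain hβ r h0 hθ
  · rintro z ⟨hz, hz0⟩
    obtain ⟨h1, h2⟩ := Complex.mem_slitPlane_iff_arg.1 hz.1
    have h : |z.arg| < Real.pi :=
      abs_lt.2 ⟨Complex.neg_pi_lt_arg z, lt_of_le_of_ne (Complex.arg_le_pi z) h1⟩
    obtain ⟨θ, hθ1, hθ2⟩ := exists_between h
    obtain ⟨h3, h4⟩ := abs_lt.1 hθ1
    exact Set.mem_biUnion ⟨θ, (abs_nonneg _).trans_lt hθ1, hθ2, rfl⟩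
      ⟨h2, by simpa using h3.le, by simpa using h4.le⟩
  · rintro _ ⟨θ, h0, hθ, rfl⟩
    exact (hc θ h0 hθ).1
  · rintro _ ⟨θ, h0, hθ, rfl⟩
    exact (hc θ h0 hθ).2 n


/-! ### Splitting the scalars into closed form and `κ` times a remainder. -/

lemma analyticAt_rhoDist {β₀ : ℝ} (hβ : 0 < β₀) (r : ℝ) : AnalyticAt ℂ (rhoDist β₀ r) 0 := by
  have hb : (β₀ : ℂ) ≠ 0 := Complex.ofReal_ne_zero.2 hβ.ne'
  have hp : (Real.pi : ℂ) ≠ 0 := Complex.ofReal_ne_zero.2 Real.pi_ne_zero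
  unfold rhoDist
  fun_prop (disch := simp [hb, hp])

lemma analyticAt_pDist {β₀ : ℝ} (hβ : 0 < β₀) (r : ℝ) : AnalyticAt ℂ (pDist β₀ r) 0 := by
  have hb : (β₀ : ℂ) ≠ 0 := Complex.ofReal_ne_zero.2 hβ.ne'
  have hp : (Real.pi : ℂ) ≠ 0 := Complex.ofReal_ne_zero.2 Real.pi_ne_zero
  unfold pDist
  fun_prop (disch := simp [hb, hp])

lemma analyticAt_aDist {β₀ : ℝ} (hβ : 0 < β₀) (r : ℝ) : AnalyticAt ℂ (aDist β₀ r) 0 := by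
  have hb : (β₀ : ℂ) ≠ 0 := Complex.ofReal_ne_zero.2 hβ.ne'
  have hp : (Real.pi : ℂ) ≠ 0 := Complex.ofReal_ne_zero.2 Real.pi_ne_zero
  unfold aDist
  fun_prop (disch := simp [hb, hp])

/-- `κ (∑ 1 / sinh² (w / 2))` without the part of it that is odd in `κ`. -/
noncomputable def invRem (β₀ : ℝ) (z : ℂ) : ℂ :=
  kappaOf z * (∑' n, (sinhHalfSq (node β₀ (kappaOf z) n))⁻¹
    - 2 * (Real.pi : ℂ) ^ 2 / (3 * z * β₀ ^ 2) - 1 / 6)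

/-- `κ (∑ 1 / sinh⁴ (w / 2))` without the part of it that is odd in `κ`. -/
noncomputable def invSqRem (β₀ : ℝ) (z : ℂ) : ℂ :=
  kappaOf z * (∑' n, (sinhHalfSq (node β₀ (kappaOf z) n))⁻¹ ^ 2
    - 8 * (Real.pi : ℂ) ^ 4 / (45 * z ^ 2 * β₀ ^ 4) + 4 * (Real.pi : ℂ) ^ 2 / (9 * z * β₀ ^ 2)
    + 11 / 90)

/-- `κ (∑ (1 + (1 + r² κ²) sinh² (w / 2))⁻¹ ^ (j + 1))` without the part of it that is odd in `κ`. -/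
noncomputable def denomRem (β₀ r : ℝ) (j : ℕ) (z : ℂ) : ℂ :=
  kappaOf z *
    (∑' n, (1 + (1 + r ^ 2 * z) * sinhHalfSq (node β₀ (kappaOf z) n))⁻¹ ^ (j + 1) + 1 / 2)

variable {β₀ r : ℝ} {z : ℂ}

lemma ne_zero_of_mem_domain (hz : z ∈ domain β₀ r) : z ≠ 0 := Complex.slitPlane_ne_zero hz.1

lemma kappaOf_ne_zero (hz : z ≠ 0) : kappaOf z ≠ 0 := fun h => hz (by
  rw [← kappaOf_sq z, h]; simp)

lemma kappaOf_four (z : ℂ) : kappaOf z ^ 4 = z ^ 2 := by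
  rw [show kappaOf z ^ 4 = (kappaOf z ^ 2) ^ 2 by ring, kappaOf_sq]

/-- The even parts of the three elementary series add up to the closed form; in the rest, `z² / κ =
κ z` produces the factor `κ`. The nested products mirror the operations under which `PowAsymp` is
closed. -/
lemma rho_eq (hβ : 0 < β₀) (hz : z ∈ domain β₀ r) :
    rho β₀ r (kappaOf z) = rhoDist β₀ r z + kappaOf z *
      (3 / (16 * (Real.pi : ℂ) ^ 2) * (z * (invSqRem β₀ z + (-1) * ((1 + r ^ 2 * z) * invRem β₀ z)
        + (1 + r ^ 2 * z) * ((1 + r ^ 2 * z) * denomRem β₀ r 0 z))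
        / (1 + r ^ 2 * z) / (1 + r ^ 2 * z))) := by
  obtain ⟨C, hC, hκ⟩ := exists_kappaOf_mem_openSector hz.1
  have hb : (β₀ : ℂ) ≠ 0 := Complex.ofReal_ne_zero.2 hβ.ne'
  have hp : (Real.pi : ℂ) ≠ 0 := Complex.ofReal_ne_zero.2 Real.pi_ne_zero
  have ha := one_add_mul_ne_zero_of_mem_slitPlane hz.1 r
  have hz0 := ne_zero_of_mem_domain hz
  have hsum := (hasSum_rhoTerm hβ hC hz hκ).tsum_eq
  have hk := kappaOf_sq z
  have hk0 := kappaOf_ne_zero hz0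
  simp only [node] at hsum
  rw [rho, hsum, kappaOf_four, kappaOf_sq, rhoDist, invSqRem, invRem, denomRem]
  simp only [node]
  -- With the sums treated as independent unknowns and `z` replaced by `κ²`, a rational identity
  -- remains.
  generalize (∑' n : ℕ, (sinhHalfSq ((n + 1 : ℕ) * kappaOf z * β₀))⁻¹ ^ 2 : ℂ) = X
  generalize (∑' n : ℕ, (sinhHalfSq ((n + 1 : ℕ) * kappaOf z * β₀))⁻¹ : ℂ) = Y
  generalize (∑' n : ℕ, (1 + (1 + r ^ 2 * z) *
    sinhHalfSq ((n + 1 : ℕ) * kappaOf z * β₀))⁻¹ ^ (0 + 1) : ℂ) = W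
  generalize kappaOf z = κ at *
  have ha' : (1 + z * r ^ 2 : ℂ) ≠ 0 := by rwa [mul_comm]
  subst hk
  field_simp
  ring

lemma pressure_eq (hβ : 0 < β₀) (hz : z ∈ domain β₀ r) :
    pressure β₀ r (kappaOf z) = pDist β₀ r z + kappaOf z *
      (1 / (16 * (Real.pi : ℂ) ^ 2) * (z * (invSqRem β₀ z
        + (1 + (-r ^ 2) * z) * invRem β₀ z
        + (-1) * ((1 + r ^ 2 * z) * ((1 + (-r ^ 2) * z) * denomRem β₀ r 0 z))
        + (-2) * ((1 + r ^ 2 * z) * denomRem β₀ r 1 z)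
        + (-4 * r ^ 2) * (z * ((1 + r ^ 2 * z) * denomRem β₀ r 2 z)))
        / (1 + r ^ 2 * z) / (1 + r ^ 2 * z))) := by
  obtain ⟨C, hC, hκ⟩ := exists_kappaOf_mem_openSector hz.1
  have hb : (β₀ : ℂ) ≠ 0 := Complex.ofReal_ne_zero.2 hβ.ne'
  have hp : (Real.pi : ℂ) ≠ 0 := Complex.ofReal_ne_zero.2 Real.pi_ne_zero
  have ha := one_add_mul_ne_zero_of_mem_slitPlane hz.1 r
  have hz0 := ne_zero_of_mem_domain hz
  have hsum := (hasSum_pTerm hβ hC hz hκ).tsum_eq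
  have hk := kappaOf_sq z
  have hk0 := kappaOf_ne_zero hz0
  simp only [node] at hsum
  rw [pressure, hsum, kappaOf_four, kappaOf_sq, pDist, invSqRem, invRem, denomRem, denomRem,
    denomRem]
  simp only [node]
  generalize (∑' n : ℕ, (sinhHalfSq ((n + 1 : ℕ) * kappaOf z * β₀))⁻¹ ^ 2 : ℂ) = X
  generalize (∑' n : ℕ, (sinhHalfSq ((n + 1 : ℕ) * kappaOf z * β₀))⁻¹ : ℂ) = Y
  generalize (∑' n : ℕ, (1 + (1 + r ^ 2 * z) *
    sinhHalfSq ((n + 1 : ℕ) * kappaOf z * β₀))⁻¹ ^ (0 + 1) : ℂ) = W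
  generalize (∑' n : ℕ, (1 + (1 + r ^ 2 * z) *
    sinhHalfSq ((n + 1 : ℕ) * kappaOf z * β₀))⁻¹ ^ (1 + 1) : ℂ) = W1
  generalize (∑' n : ℕ, (1 + (1 + r ^ 2 * z) *
    sinhHalfSq ((n + 1 : ℕ) * kappaOf z * β₀))⁻¹ ^ (2 + 1) : ℂ) = W2
  generalize kappaOf z = κ at *
  have ha' : (1 + z * r ^ 2 : ℂ) ≠ 0 := by rwa [mul_comm]
  subst hk
  field_simp
  ring

lemma aCoeff_eq (hβ : 0 < β₀) (hz : z ∈ domain β₀ r) :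
    aCoeff β₀ r (kappaOf z) = aDist β₀ r z + kappaOf z *
      (1 / (8 * (Real.pi : ℂ) ^ 2) * ((invRem β₀ z
        + (-1) * ((1 + r ^ 2 * z) * denomRem β₀ r 0 z)
        + (-1) * ((1 + r ^ 2 * z) * denomRem β₀ r 1 z)
        + 2 * ((1 + r ^ 2 * z) * denomRem β₀ r 2 z))
        / (1 + r ^ 2 * z))) := by
  obtain ⟨C, hC, hκ⟩ := exists_kappaOf_mem_openSector hz.1
  have hb : (β₀ : ℂ) ≠ 0 := Complex.ofReal_ne_zero.2 hβ.ne'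
  have hp : (Real.pi : ℂ) ≠ 0 := Complex.ofReal_ne_zero.2 Real.pi_ne_zero
  have ha := one_add_mul_ne_zero_of_mem_slitPlane hz.1 r
  have hz0 := ne_zero_of_mem_domain hz
  have hsum := (hasSum_aTerm hβ hC hz hκ).tsum_eq
  have hk := kappaOf_sq z
  have hk0 := kappaOf_ne_zero hz0
  simp only [node] at hsum
  rw [aCoeff, hsum, kappaOf_sq, aDist, invRem, denomRem, denomRem, denomRem]
  simp only [node]
  generalize (∑' n : ℕ, (sinhHalfSq ((n + 1 : ℕ) * kappaOf z * β₀))⁻¹ : ℂ) = Y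
  generalize (∑' n : ℕ, (1 + (1 + r ^ 2 * z) *
    sinhHalfSq ((n + 1 : ℕ) * kappaOf z * β₀))⁻¹ ^ (0 + 1) : ℂ) = W
  generalize (∑' n : ℕ, (1 + (1 + r ^ 2 * z) *
    sinhHalfSq ((n + 1 : ℕ) * kappaOf z * β₀))⁻¹ ^ (1 + 1) : ℂ) = W1
  generalize (∑' n : ℕ, (1 + (1 + r ^ 2 * z) *
    sinhHalfSq ((n + 1 : ℕ) * kappaOf z * β₀))⁻¹ ^ (2 + 1) : ℂ) = W2
  generalize kappaOf z = κ at *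
  have ha' : (1 + z * r ^ 2 : ℂ) ≠ 0 := by rwa [mul_comm]
  subst hk
  field_simp
  ring

theorem isAnalyticDistillate_rho (hβ : 0 < β₀) (r : ℝ) :
    IsAnalyticDistillate (fun z => rho β₀ r (kappaOf z)) (domain β₀ r) 0 (rhoDist β₀ r) := by
  refine isAnalyticDistillate_of_powAsymp hβ r (analyticAt_rhoDist hβ r)
    (fun C hC l hl hS => ?_) fun z hz => rho_eq hβ hz
  have h1 : PowAsymp l (invRem β₀) := powAsymp_tsum_inv_sinhHalfSq hβ hC hl hS
  have h2 : PowAsymp l (invSqRem β₀) := powAsymp_tsum_inv_sinhHalfSq_sq hβ hC hl hS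
  have h3 : PowAsymp l (denomRem β₀ r 0) := powAsymp_tsum_inv_one_add_mul hβ hC hl hS r 0
  have L := fun {f} (hf : PowAsymp l f) => hf.linear_mul hl 1 (r ^ 2)
  exact ((((h2.add ((L h1).const_mul _)).add (L (L h3))).id_mul hl).div_linear hl _
    |>.div_linear hl _).const_mul _

theorem isAnalyticDistillate_pressure (hβ : 0 < β₀) (r : ℝ) :
    IsAnalyticDistillate (fun z => pressure β₀ r (kappaOf z)) (domain β₀ r) 0 (pDist β₀ r) := by
  refine isAnalyticDistillate_of_powAsymp hβ r (analyticAt_pDist hβ r)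
    (fun C hC l hl hS => ?_) fun z hz => pressure_eq hβ hz
  have h1 : PowAsymp l (invRem β₀) := powAsymp_tsum_inv_sinhHalfSq hβ hC hl hS
  have h2 : PowAsymp l (invSqRem β₀) := powAsymp_tsum_inv_sinhHalfSq_sq hβ hC hl hS
  have h3 : ∀ j, PowAsymp l (denomRem β₀ r j) := powAsymp_tsum_inv_one_add_mul hβ hC hl hS r
  have L := fun {f} (hf : PowAsymp l f) => hf.linear_mul hl 1 (r ^ 2)
  exact (((((((h2.add (h1.linear_mul hl 1 _)).add
    ((L ((h3 0).linear_mul hl 1 _)).const_mul _)).add ((L (h3 1)).const_mul _)).add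
    (((L (h3 2)).id_mul hl).const_mul _)).id_mul hl).div_linear hl _).div_linear hl _).const_mul _

theorem isAnalyticDistillate_aCoeff (hβ : 0 < β₀) (r : ℝ) :
    IsAnalyticDistillate (fun z => aCoeff β₀ r (kappaOf z)) (domain β₀ r) 0 (aDist β₀ r) := by
  refine isAnalyticDistillate_of_powAsymp hβ r (analyticAt_aDist hβ r)
    (fun C hC l hl hS => ?_) fun z hz => aCoeff_eq hβ hz
  have h1 : PowAsymp l (invRem β₀) := powAsymp_tsum_inv_sinhHalfSq hβ hC hl hS
  have h3 : ∀ j, PowAsymp l (denomRem β₀ r j) := powAsymp_tsum_inv_one_add_mul hβ hC hl hS r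
  have L := fun {f} (hf : PowAsymp l f) => hf.linear_mul hl 1 (r ^ 2)
  exact ((((h1.add ((L (h3 0)).const_mul _)).add ((L (h3 1)).const_mul _)).add
    ((L (h3 2)).const_mul _)).div_linear hl _).const_mul _


/-! ### The geometry of the AdS chart -/

/-- The metric and its Christoffel symbols depend only on the radius and the polar angle. -/
lemma pd_comp_radius_polar (h : ℝ → ℝ → ℝ) (μ : Fin 4) (x : Fin 4 → ℝ) :
    pd μ (fun y => h (y 1) (y 2)) x =
      ![0, deriv (fun s => h s (x 2)) (x 1), deriv (fun s => h (x 1) s) (x 2), 0] μ := by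
  fin_cases μ <;> simp [pd, Function.update]

/-- The components of the AdS metric as functions of the radius and of the polar angle. -/
noncomputable def adsDiag (κ a b : ℝ) : Fin 4 → ℝ :=
  ![1 + a ^ 2 * κ ^ 2, -(1 + a ^ 2 * κ ^ 2)⁻¹, -a ^ 2, -(a ^ 2 * Real.sin b ^ 2)]

lemma adsMetric_apply (κ : ℝ) (x : Fin 4 → ℝ) (μ ν : Fin 4) :
    adsMetric κ x μ ν = if μ = ν then adsDiag κ (x 1) (x 2) μ else 0 := by
  rw [adsMetric, Matrix.diagonal_apply]; rfl

lemma one_add_sq_mul_sq_pos (a κ : ℝ) : 0 < 1 + a ^ 2 * κ ^ 2 := by positivity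

lemma adsMetric_inv_apply {κ : ℝ} {x : Fin 4 → ℝ} (h1 : x 1 ≠ 0) (h2 : Real.sin (x 2) ≠ 0)
    (μ ν : Fin 4) :
    (adsMetric κ x)⁻¹ μ ν = if μ = ν then (adsDiag κ (x 1) (x 2) μ)⁻¹ else 0 := by
  have hf := (one_add_sq_mul_sq_pos (x 1) κ).ne'
  have hinv : (adsMetric κ x)⁻¹ = Matrix.diagonal fun μ => (adsDiag κ (x 1) (x 2) μ)⁻¹ := by
    refine Matrix.inv_eq_right_inv ?_
    change Matrix.diagonal (adsDiag κ (x 1) (x 2)) * _ = 1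
    rw [Matrix.diagonal_mul_diagonal, ← Matrix.diagonal_one]
    congr 1
    funext μ
    refine mul_inv_cancel₀ ?_
    fin_cases μ <;> simp [adsDiag, h1, h2, hf]
  rw [hinv, Matrix.diagonal_apply]

/-- The partial derivatives of the components of the metric. -/
noncomputable def adsDeriv (κ a b : ℝ) (μ ν : Fin 4) : ℝ :=
  ![![0, 2 * a * κ ^ 2, 0, 0],
    ![0, 2 * a * κ ^ 2 / (1 + a ^ 2 * κ ^ 2) ^ 2, 0, 0],
    ![0, -(2 * a), 0, 0],
    ![0, -(2 * a * Real.sin b ^ 2), -(a ^ 2 * (2 * Real.sin b * Real.cos b)), 0]] ν μ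

lemma pd_adsMetric (κ : ℝ) (x : Fin 4 → ℝ) (μ σ ν : Fin 4) :
    pd μ (fun y => adsMetric κ y σ ν) x =
      if σ = ν then adsDeriv κ (x 1) (x 2) μ σ else 0 := by
  simp only [adsMetric_apply]
  by_cases h : σ = ν
  · simp only [h, if_true]
    rw [pd_comp_radius_polar (fun a b => adsDiag κ a b ν)]
    have hf := (one_add_sq_mul_sq_pos (x 1) κ).ne'
    have d0 : HasDerivAt (fun s : ℝ => 1 + s ^ 2 * κ ^ 2) (2 * x 1 * κ ^ 2) (x 1) := by
      simpa using ((hasDerivAt_pow 2 (x 1)).mul_const (κ ^ 2)).const_add 1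
    have d1 := (d0.fun_inv hf).fun_neg.deriv
    have d2 : HasDerivAt (fun s : ℝ => s ^ 2) (2 * x 1) (x 1) := by
      simpa using hasDerivAt_pow 2 (x 1)
    have d3 := (d2.mul_const (Real.sin (x 2) ^ 2)).fun_neg.deriv
    have d4 : HasDerivAt (fun s : ℝ => Real.sin s ^ 2) (2 * Real.sin (x 2) * Real.cos (x 2))
        (x 2) := by
      simpa using (Real.hasDerivAt_sin (x 2)).fun_pow 2
    have d5 := (d4.const_mul (x 1 ^ 2)).fun_neg.deriv
    have d6 := d2.fun_neg.deriv
    fin_cases ν <;> fin_cases μ <;>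
      simp [adsDiag, adsDeriv, d0.deriv, d1, d3, d5, d6, neg_div]
  · simp only [h, if_false]
    simp [pd]

/-- The Christoffel symbols as functions of the radius and of the polar angle. -/
noncomputable def adsChristoffel (κ a b : ℝ) (l μ ν : Fin 4) : ℝ :=
  ![![![0, a * κ ^ 2 / (1 + a ^ 2 * κ ^ 2), 0, 0],
      ![a * κ ^ 2 / (1 + a ^ 2 * κ ^ 2), 0, 0, 0],
      ![0, 0, 0, 0],
      ![0, 0, 0, 0]],
    ![![a * κ ^ 2 * (1 + a ^ 2 * κ ^ 2), 0, 0, 0],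
      ![0, -(a * κ ^ 2 / (1 + a ^ 2 * κ ^ 2)), 0, 0],
      ![0, 0, -(a * (1 + a ^ 2 * κ ^ 2)), 0],
      ![0, 0, 0, -(a * (1 + a ^ 2 * κ ^ 2) * Real.sin b ^ 2)]],
    ![![0, 0, 0, 0],
      ![0, 0, a⁻¹, 0],
      ![0, a⁻¹, 0, 0],
      ![0, 0, 0, -(Real.sin b * Real.cos b)]],
    ![![0, 0, 0, 0],
      ![0, 0, 0, a⁻¹],
      ![0, 0, 0, Real.cos b / Real.sin b],
      ![0, a⁻¹, Real.cos b / Real.sin b, 0]]] l μ ν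

lemma christoffel_adsMetric {κ : ℝ} {x : Fin 4 → ℝ} (h1 : x 1 ≠ 0) (h2 : Real.sin (x 2) ≠ 0)
    (l μ ν : Fin 4) :
    christoffel (adsMetric κ) l μ ν x = adsChristoffel κ (x 1) (x 2) l μ ν := by
  have hf := (one_add_sq_mul_sq_pos (x 1) κ).ne'
  simp only [christoffel, adsMetric_inv_apply h1 h2, pd_adsMetric, ite_mul, zero_mul,
    Finset.sum_ite_eq, Finset.mem_univ, if_true]
  generalize x 1 = a at *
  generalize x 2 = b at *
  fin_cases l <;> fin_cases μ <;> fin_cases ν <;>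
    simp [adsDiag, adsDeriv, adsChristoffel] <;> field_simp <;> ring

lemma pd_christoffel_adsMetric {κ : ℝ} {x : Fin 4 → ℝ} (h1 : x 1 ≠ 0)
    (h2 : Real.sin (x 2) ≠ 0) (σ l μ ν : Fin 4) :
    pd σ (christoffel (adsMetric κ) l μ ν) x =
      ![0, deriv (fun s => adsChristoffel κ s (x 2) l μ ν) (x 1),
        deriv (fun s => adsChristoffel κ (x 1) s l μ ν) (x 2), 0] σ := by
  rw [← pd_comp_radius_polar fun a b => adsChristoffel κ a b l μ ν]
  -- The closed form holds only where the radius and `sin θ` are nonzero; this is an open condition,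
  -- which suffices for a derivative.
  refine Filter.EventuallyEq.deriv_eq ?_
  have hc : Continuous fun s => Function.update x σ s := continuous_const.update σ continuous_id
  have e1 : ContinuousAt (fun s => Function.update x σ s 1) (x σ) :=
    ((continuous_apply 1).comp hc).continuousAt
  have e2 : ContinuousAt (fun s => Real.sin (Function.update x σ s 2)) (x σ) :=
    (Real.continuous_sin.comp ((continuous_apply 2).comp hc)).continuousAt
  filter_upwards [e1.eventually_ne (by simpa using h1), e2.eventually_ne (by simpa using h2)]
    with s hs1 hs2
  exact christoffel_adsMetric hs1 hs2 l μ ν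

/-- AdS is an Einstein space. -/
lemma ricci_adsMetric {κ : ℝ} {x : Fin 4 → ℝ} (h1 : x 1 ≠ 0) (h2 : Real.sin (x 2) ≠ 0)
    (μ : Fin 4) : ricci (adsMetric κ) μ μ x = -3 * κ ^ 2 * adsDiag κ (x 1) (x 2) μ := by
  have hf := (one_add_sq_mul_sq_pos (x 1) κ).ne'
  have d0 : HasDerivAt (fun s : ℝ => 1 + s ^ 2 * κ ^ 2) (2 * x 1 * κ ^ 2) (x 1) := by
    simpa using ((hasDerivAt_pow 2 (x 1)).mul_const (κ ^ 2)).const_add 1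
  have dk : HasDerivAt (fun s : ℝ => s * κ ^ 2) (κ ^ 2) (x 1) := by
    simpa using (hasDerivAt_id (x 1)).mul_const (κ ^ 2)
  have da : HasDerivAt (fun s : ℝ => s) 1 (x 1) := hasDerivAt_id (x 1)
  have d1 := (dk.fun_div d0 hf).deriv
  have d1' := (dk.fun_div d0 hf).fun_neg.deriv
  have d2 := (dk.fun_mul d0).deriv
  have d3 := (da.fun_mul d0).fun_neg.deriv
  have d4 := ((da.fun_mul d0).mul_const (Real.sin (x 2) ^ 2)).fun_neg.deriv
  have d5 := (da.fun_inv h1).deriv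
  have d6 := ((Real.hasDerivAt_sin (x 2)).fun_mul (Real.hasDerivAt_cos (x 2))).fun_neg.deriv
  have d7 := ((Real.hasDerivAt_cos (x 2)).fun_div (Real.hasDerivAt_sin (x 2)) h2).deriv
  simp only [ricci, riemann, pd_christoffel_adsMetric h1 h2, christoffel_adsMetric h1 h2,
    Fin.sum_univ_four]
  fin_cases μ <;>
    simp [adsDiag, adsChristoffel, d1, d1', d2, d3, d4, d5, d6, d7] <;>
    field_simp <;> ring

lemma scalarCurvature_adsMetric {κ : ℝ} {x : Fin 4 → ℝ} (h1 : x 1 ≠ 0)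
    (h2 : Real.sin (x 2) ≠ 0) : scalarCurvature (adsMetric κ) x = -12 * κ ^ 2 := by
  have hf := (one_add_sq_mul_sq_pos (x 1) κ).ne'
  simp only [scalarCurvature, adsMetric_inv_apply h1 h2, ite_mul, zero_mul, Finset.sum_ite_eq,
    Finset.mem_univ, if_true, ricci_adsMetric h1 h2]
  have : ∀ μ, adsDiag κ (x 1) (x 2) μ ≠ 0 := by
    intro μ
    fin_cases μ <;> simp [adsDiag, h1, h2, hf]
  -- The inverse metric is diagonal, so only diagonal Ricci components enter, and each of the four
  -- contributes `-3 κ²`.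
  have e : ∀ μ, (adsDiag κ (x 1) (x 2) μ)⁻¹ * (-3 * κ ^ 2 * adsDiag κ (x 1) (x 2) μ) =
      -3 * κ ^ 2 := fun μ => by
    have := this μ
    field_simp
  simp only [e, Fin.sum_univ_four]
  ring

lemma normSq_adsMetric (κ β₀ : ℝ) (x : Fin 4 → ℝ) :
    normSq (adsMetric κ) (fourTemperature β₀) x = (1 + x 1 ^ 2 * κ ^ 2) * β₀ ^ 2 := by
  simp only [normSq, adsMetric_apply, Fin.sum_univ_four, fourTemperature, adsDiag]
  simp
  ring

lemma velocityLow_adsMetric (κ β₀ : ℝ) (x : Fin 4 → ℝ) (μ : Fin 4) :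
    velocityLow (adsMetric κ) (fourTemperature β₀) x μ =
      ![(1 + x 1 ^ 2 * κ ^ 2) * (β₀ / Real.sqrt ((1 + x 1 ^ 2 * κ ^ 2) * β₀ ^ 2)), 0, 0, 0] μ := by
  simp only [velocityLow, velocity, normSq_adsMetric, adsMetric_apply, ite_mul, zero_mul,
    Finset.sum_ite_eq, Finset.mem_univ, if_true]
  fin_cases μ <;> simp [fourTemperature, adsDiag]

lemma accelerationSq_adsMetric {κ β₀ : ℝ} (hβ : 0 < β₀) {x : Fin 4 → ℝ} (h1 : x 1 ≠ 0)
    (h2 : Real.sin (x 2) ≠ 0) :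
    accelerationSq (adsMetric κ) (fourTemperature β₀) x =
      -(x 1 ^ 2 * κ ^ 4 / (1 + x 1 ^ 2 * κ ^ 2)) := by
  have hf := one_add_sq_mul_sq_pos (x 1) κ
  have hs : Real.sqrt ((1 + x 1 ^ 2 * κ ^ 2) * β₀ ^ 2) ^ 2 = (1 + x 1 ^ 2 * κ ^ 2) * β₀ ^ 2 :=
    Real.sq_sqrt (by positivity)
  have hs0 : Real.sqrt ((1 + x 1 ^ 2 * κ ^ 2) * β₀ ^ 2) ≠ 0 :=
    (Real.sqrt_pos.2 (by positivity)).ne'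
  -- Everything is static and `u` has only a time component, so the acceleration is `-u⁰ u₀
  -- Γ⁰_{0μ}`, with `u⁰ u₀ = 1`.
  have hA : ∀ μ, acceleration (adsMetric κ) (fourTemperature β₀) x μ =
      ![0, -(x 1 * κ ^ 2 / (1 + x 1 ^ 2 * κ ^ 2)), 0, 0] μ := by
    intro μ
    have hpd : pd 0 (fun y => velocityLow (adsMetric κ) (fourTemperature β₀) y μ) x = 0 := by
      simp [pd, velocityLow_adsMetric]
    rw [acceleration, Fin.sum_univ_four]
    have hv : ∀ ν : Fin 4, velocity (adsMetric κ) (fourTemperature β₀) x ν =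
        ![β₀ / Real.sqrt ((1 + x 1 ^ 2 * κ ^ 2) * β₀ ^ 2), 0, 0, 0] ν := by
      intro ν
      rw [velocity, normSq_adsMetric]
      fin_cases ν <;> simp [fourTemperature]
    rw [hpd]
    simp only [hv, Fin.sum_univ_four, velocityLow_adsMetric, christoffel_adsMetric h1 h2]
    generalize Real.sqrt ((1 + x 1 ^ 2 * κ ^ 2) * β₀ ^ 2) = q at *
    fin_cases μ <;> simp [adsChristoffel]
    field_simp
    linear_combination (-κ ^ 2) * hs
  simp only [accelerationSq, adsMetric_inv_apply h1 h2, hA, ite_mul, zero_mul, Finset.sum_ite_eq,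
    Finset.mem_univ, if_true, Fin.sum_univ_four, adsDiag]
  simp
  field_simp
  ring


section closedForms

variable {β₀ κ : ℝ} {x : Fin 4 → ℝ}

lemma temperature_sq_adsMetric :
    temperature (adsMetric κ) (fourTemperature β₀) x ^ 2 =
      1 / ((1 + x 1 ^ 2 * κ ^ 2) * β₀ ^ 2) := by
  rw [temperature, normSq_adsMetric, div_pow, one_pow, Real.sq_sqrt (by positivity)]

lemma unruhSq_adsMetric (hβ : 0 < β₀) (h1 : x 1 ≠ 0) (h2 : Real.sin (x 2) ≠ 0) :
    unruhSq (adsMetric κ) (fourTemperature β₀) x =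
      -κ ^ 2 / (4 * Real.pi ^ 2 * (1 + x 1 ^ 2 * κ ^ 2)) := by
  have hf := (one_add_sq_mul_sq_pos (x 1) κ).ne'
  rw [unruhSq, scalarCurvature_adsMetric h1 h2, accelerationSq_adsMetric hβ h1 h2]
  field_simp
  ring

end closedForms

end AdSDistillate

theorem mainTheorem3 (β₀ : ℝ) (hβ₀ : 0 < β₀) :
    (∀ r : ℝ, 0 ≤ r →
      (∀ κ : ℝ, 0 < κ → (κ : ℂ) ^ 2 ∈ AdSDistillate.domain β₀ r) ∧
      (∀ z ∈ AdSDistillate.domain β₀ r,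
        Summable (fun n : ℕ => AdSDistillate.rhoTerm r (AdSDistillate.kappaOf z)
          ((n + 1 : ℕ) * AdSDistillate.kappaOf z * β₀)) ∧
        Summable (fun n : ℕ => AdSDistillate.pTerm r (AdSDistillate.kappaOf z)
          ((n + 1 : ℕ) * AdSDistillate.kappaOf z * β₀)) ∧
        Summable (fun n : ℕ => AdSDistillate.aTerm r (AdSDistillate.kappaOf z)
          ((n + 1 : ℕ) * AdSDistillate.kappaOf z * β₀))) ∧
      AdSDistillate.IsAnalyticDistillate
        (fun z => AdSDistillate.rho β₀ r (AdSDistillate.kappaOf z))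
        (AdSDistillate.domain β₀ r) 0 (AdSDistillate.rhoDist β₀ r) ∧
      AdSDistillate.IsAnalyticDistillate
        (fun z => AdSDistillate.pressure β₀ r (AdSDistillate.kappaOf z))
        (AdSDistillate.domain β₀ r) 0 (AdSDistillate.pDist β₀ r) ∧
      AdSDistillate.IsAnalyticDistillate
        (fun z => AdSDistillate.aCoeff β₀ r (AdSDistillate.kappaOf z))
        (AdSDistillate.domain β₀ r) 0 (AdSDistillate.aDist β₀ r)) ∧
    (∀ (κ : ℝ) (x : Fin 4 → ℝ), 0 < κ → 0 < x 1 → 0 < x 2 → x 2 < Real.pi →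
      ∀ R A2 βsq T TU2 : ℝ,
        R = AdSDistillate.scalarCurvature (AdSDistillate.adsMetric κ) x →
        A2 = AdSDistillate.accelerationSq (AdSDistillate.adsMetric κ)
          (AdSDistillate.fourTemperature β₀) x →
        βsq = AdSDistillate.normSq (AdSDistillate.adsMetric κ)
          (AdSDistillate.fourTemperature β₀) x →
        T = AdSDistillate.temperature (AdSDistillate.adsMetric κ)
          (AdSDistillate.fourTemperature β₀) x →
        TU2 = AdSDistillate.unruhSq (AdSDistillate.adsMetric κ)
          (AdSDistillate.fourTemperature β₀) x →
        -- in terms of the curvature scalar, the acceleration and the four-temperature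
        AdSDistillate.rhoDist β₀ (x 1) ((κ : ℂ) ^ 2) =
          ((Real.pi ^ 2 / (30 * βsq ^ 2) + 1 / (12 * βsq) * (5 / 2 * (R / 12) - A2)
            + 1 / (480 * Real.pi ^ 2) *
              (-71 * (R / 12) ^ 2 + 37 * (R / 12) * A2 - 11 * A2 ^ 2) : ℝ) : ℂ) ∧
        AdSDistillate.pDist β₀ (x 1) ((κ : ℂ) ^ 2) =
          ((Real.pi ^ 2 / (90 * βsq ^ 2) + 1 / (18 * βsq) * (A2 - 1 / 4 * (R / 12))
            + 1 / (1440 * Real.pi ^ 2) *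
              (139 * (R / 12) ^ 2 - 23 * (R / 12) * A2 + 19 * A2 ^ 2) : ℝ) : ℂ) ∧
        AdSDistillate.aDist β₀ (x 1) ((κ : ℂ) ^ 2) =
          ((1 / (12 * βsq) - 1 / (48 * Real.pi ^ 2) * (R / 12 - A2) : ℝ) : ℂ) ∧
        -- in terms of the proper temperature and the Unruh temperature
        AdSDistillate.rhoDist β₀ (x 1) ((κ : ℂ) ^ 2) =
          ((Real.pi ^ 2 / 30 * (T ^ 4 + 10 * T ^ 2 * TU2 - 11 * TU2 ^ 2)
            + 1 / 96 * R * (T ^ 2 - TU2) - 3 / (32 * Real.pi ^ 2) * (R / 12) ^ 2 : ℝ) : ℂ) ∧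
        AdSDistillate.pDist β₀ (x 1) ((κ : ℂ) ^ 2) =
          ((Real.pi ^ 2 / 90 * (T ^ 4 - 20 * T ^ 2 * TU2 + 19 * TU2 ^ 2)
            + 1 / 288 * R * (T ^ 2 - TU2) + 3 / (32 * Real.pi ^ 2) * (R / 12) ^ 2 : ℝ) : ℂ) ∧
        AdSDistillate.aDist β₀ (x 1) ((κ : ℂ) ^ 2) =
          ((1 / 12 * (T ^ 2 - TU2) : ℝ) : ℂ)) := by
  refine ⟨fun r _ => ⟨fun κ hκ => AdSDistillate.ofReal_sq_mem_domain hκ β₀ r, fun z hz => ?_,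
    AdSDistillate.isAnalyticDistillate_rho hβ₀ r, AdSDistillate.isAnalyticDistillate_pressure hβ₀ r,
    AdSDistillate.isAnalyticDistillate_aCoeff hβ₀ r⟩, ?_⟩
  -- Pointwise convergence needs only some sector containing `κ`; in `ℂ`, summability is absolute
  -- convergence.
  · obtain ⟨C, hC, hκ⟩ := AdSDistillate.exists_kappaOf_mem_openSector hz.1
    exact ⟨(AdSDistillate.hasSum_rhoTerm hβ₀ hC hz hκ).summable,
      (AdSDistillate.hasSum_pTerm hβ₀ hC hz hκ).summable,
      (AdSDistillate.hasSum_aTerm hβ₀ hC hz hκ).summable⟩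
  · intro κ x _ hx1 hx2 hx2' R A2 βsq T TU2 hR hA hβsq hT hTU
    have h1 := hx1.ne'
    have h2 := (Real.sin_pos_of_pos_of_lt_pi hx2 hx2').ne'
    rw [AdSDistillate.scalarCurvature_adsMetric h1 h2] at hR
    rw [AdSDistillate.accelerationSq_adsMetric hβ₀ h1 h2] at hA
    rw [AdSDistillate.normSq_adsMetric] at hβsq
    rw [AdSDistillate.unruhSq_adsMetric hβ₀ h1 h2] at hTU
    -- Only even powers of `T` occur, so the square root disappears.
    have hT2 : T ^ 2 = 1 / ((1 + x 1 ^ 2 * κ ^ 2) * β₀ ^ 2) := by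
      rw [hT, AdSDistillate.temperature_sq_adsMetric]
    have hT4 : T ^ 4 = (1 / ((1 + x 1 ^ 2 * κ ^ 2) * β₀ ^ 2)) ^ 2 := by
      rw [← hT2]; ring
    have hf := (AdSDistillate.one_add_sq_mul_sq_pos (x 1) κ).ne'
    have hfC : (1 + (x 1 : ℂ) ^ 2 * (κ : ℂ) ^ 2) ≠ 0 := by exact_mod_cast hf
    have hb : (β₀ : ℂ) ≠ 0 := Complex.ofReal_ne_zero.2 hβ₀.ne'
    have hp : (Real.pi : ℂ) ≠ 0 := Complex.ofReal_ne_zero.2 Real.pi_ne_zero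
    rw [hT4, hT2, hR, hA, hβsq, hTU]
    simp only [AdSDistillate.rhoDist, AdSDistillate.pDist, AdSDistillate.aDist]
    push_cast
    refine ⟨?_, ?_, ?_, ?_, ?_, ?_⟩ <;> field_simp <;> ring
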